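/- Let $n,d\ge 0$ and let $X=\begin{pmatrix}x_1&\cdots&x_n\\ y_1&\cdots&y_n\end{pmatrix}$ be a matrix of $2n$ variables. Let $\mathcal R_n=\mathbb C[X]^{SL_2}$ be the ring of polynomials $f$ with $f(AX)=f(X)$ for all $A\in SL_2(\mathbb C)$, graded so that the $2\times 2$ minors of $X$ have degree $1$; thus the component $\mathcal R_n^{(d)}$ of degree $d$ consists of the invariants that are homogeneous of degree $2d$ in the entries of $X$. The group $GL_n(\mathbb C)$ acts on $\mathcal R_n^{(d)}$ by $(g\cdot f)(X)=f(Xg)$, and $\mathbb S_n$ acts on it by permuting the $n$ columns of $X$. Let $s_{dd}$ be the Schur function of the partition $(d,d)$. 1. The character of $GL_n$ on $\mathcal R_n^{(d)}$ is $s_{dd}(q_1,\dots,q_n)$; that is, the trace of $\mathrm{diag}(q_1,\dots,q_n)\in GL_n(\mathbb C)$ on $\mathcal R_n^{(d)}$ is $s_{dd}(q_1,\dots,q_n)$. The trace of $\sigma\in\mathbb S_n$ on $\mathcal R_n^{(d)}$ is the value of $s_{dd}(q_1,\dots,q_n)$ at the eigenvalues $q_1,\dots,q_n$ (with multiplicity)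 of the permutation matrix of $\sigma$. 2. The Frobenius characteristic $\mathrm{Frob}(\mathcal R_n^{(d)})(\mathbf z)=\frac1{n!}\sum_{\sigma\in\mathbb S_n}\chi(\sigma)\,p_{\lambda(\sigma)}(\mathbf z)$, where $\chi$ is the character of $\mathbb S_n$ on $\mathcal R_n^{(d)}$ and $\lambda(\sigma)$ is the partition of $n$ formed by the cycle lengths of $\sigma$, is $$\mathrm{Frob}(\mathcal R_n^{(d)})(\mathbf z)=\sum_{\mu\vdash n} s_{dd}\Big|_{p_k\leftarrow\varphi_k(\mu)}\ \frac{p_\mu(\mathbf z)}{z_\mu},\qquad \varphi_k(\mu)=\sum_{\mu_i\mid k}\mu_i .$$ Here $\mathbf z=z_1,z_2,\dots$, $p_k(\mathbf z)=\sum_i z_i^k$, $p_\mu=\prod_i p_{\mu_i}$, $z_\mu=\prod_i i^{m_i}m_i!$ with $m_i$ the number of parts of $\mu$ equal to $i$, and $s_{dd}|_{p_k\leftarrow\varphi_k(\mu)}$ is obtained by writing $s_{dd}$ as a polynomial in the power sums $p_1,p_2,\dots$ (which is possible) and replacing each $p_k$ by the number $\varphi_k(\mu)$. -/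

import Mathlib

open scoped BigOperators

namespace SLTwoInvariants

noncomputable section

/-! ### The ring of invariants -/

/-- The polynomial ring `ℂ[X]` in the entries of a generic `2 × n` matrix `X`; the variable
`(0, j)` is `x_j` and the variable `(1, j)` is `y_j`. -/
abbrev PolyRing (n : ℕ) : Type := MvPolynomial (Fin 2 × Fin n) ℂ

/-- The substitution `f(X) ↦ f(A X)`, for a `2 × 2` matrix `A`. -/
def leftSubst (n : ℕ) (A : Matrix (Fin 2) (Fin 2) ℂ) : PolyRing n →ₐ[ℂ] PolyRing n :=
  MvPolynomial.aeval fun v => ∑ k, MvPolynomial.C (A v.1 k) * MvPolynomial.X (k, v.2)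

/-- The substitution `f(X) ↦ f(X g)`, for an `n × n` matrix `g`. -/
def rightSubst (n : ℕ) (g : Matrix (Fin n) (Fin n) ℂ) : PolyRing n →ₐ[ℂ] PolyRing n :=
  MvPolynomial.aeval fun v => ∑ k, MvPolynomial.C (g k v.2) * MvPolynomial.X (v.1, k)

/-- The permutation of the columns of `X`: the variables of column `j` are replaced by those of
column `σ j`. -/
def columnSubst (n : ℕ) (σ : Equiv.Perm (Fin n)) : PolyRing n →ₐ[ℂ] PolyRing n :=
  MvPolynomial.rename fun v => (v.1, σ v.2)

/-- The ring `R_n = ℂ[X]^{SL_2}`. -/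
def invariantRing (n : ℕ) : Subalgebra ℂ (PolyRing n) :=
  ⨅ A : Matrix.SpecialLinearGroup (Fin 2) ℂ,
    AlgHom.equalizer (leftSubst n (A : Matrix (Fin 2) (Fin 2) ℂ)) (AlgHom.id ℂ (PolyRing n))

/-- The degree `d` component of `R_n`, where the `2 × 2` minors of `X` have degree `1`: the
invariants that are homogeneous of degree `2 d` in the entries of `X`. -/
def invariantComponent (n d : ℕ) : Submodule ℂ (PolyRing n) :=
  Subalgebra.toSubmodule (invariantRing n) ⊓
    MvPolynomial.homogeneousSubmodule (Fin 2 × Fin n) ℂ (2 * d)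

theorem mem_invariantComponent {n d : ℕ} {f : PolyRing n} :
    f ∈ invariantComponent n d ↔
      (∀ A : Matrix.SpecialLinearGroup (Fin 2) ℂ,
        leftSubst n (A : Matrix (Fin 2) (Fin 2) ℂ) f = f) ∧ f.IsHomogeneous (2 * d) := by
  simp [invariantComponent, invariantRing, AlgHom.mem_equalizer]

theorem leftSubst_rightSubst (n : ℕ) (A : Matrix (Fin 2) (Fin 2) ℂ)
    (g : Matrix (Fin n) (Fin n) ℂ) (f : PolyRing n) :
    leftSubst n A (rightSubst n g f) = rightSubst n g (leftSubst n A f) := by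
  have h : (leftSubst n A).comp (rightSubst n g) = (rightSubst n g).comp (leftSubst n A) := by
    apply MvPolynomial.algHom_ext
    intro v
    simp only [leftSubst, rightSubst, AlgHom.comp_apply, MvPolynomial.aeval_X, map_sum, map_mul,
      MvPolynomial.algHom_C, MvPolynomial.algebraMap_eq, Finset.mul_sum]
    rw [Finset.sum_comm]
    exact Finset.sum_congr rfl fun _ _ => Finset.sum_congr rfl fun _ _ => by ring
  exact DFunLike.congr_fun h f

theorem leftSubst_columnSubst (n : ℕ) (A : Matrix (Fin 2) (Fin 2) ℂ)
    (σ : Equiv.Perm (Fin n)) (f : PolyRing n) :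
    leftSubst n A (columnSubst n σ f) = columnSubst n σ (leftSubst n A f) := by
  have h : (leftSubst n A).comp (columnSubst n σ) = (columnSubst n σ).comp (leftSubst n A) := by
    apply MvPolynomial.algHom_ext
    intro v
    simp [leftSubst, columnSubst]
  exact DFunLike.congr_fun h f

/-- `GL_n` acts on `ℂ[X]` by `(g • f)(X) = f(X g)`. -/
def glPolyRep (n : ℕ) : Representation ℂ (Matrix.GeneralLinearGroup (Fin n) ℂ) (PolyRing n) where
  toFun g := (rightSubst n (g : Matrix (Fin n) (Fin n) ℂ)).toLinearMap
  map_one' := by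
    have h : rightSubst n (1 : Matrix (Fin n) (Fin n) ℂ) = AlgHom.id ℂ (PolyRing n) := by
      apply MvPolynomial.algHom_ext
      intro v
      simp [rightSubst, Matrix.one_apply, apply_ite MvPolynomial.C]
    refine LinearMap.ext fun f => ?_
    simp [h]
  map_mul' g g' := by
    have h : rightSubst n ((g : Matrix (Fin n) (Fin n) ℂ) * (g' : Matrix (Fin n) (Fin n) ℂ)) =
        (rightSubst n (g : Matrix (Fin n) (Fin n) ℂ)).comp
          (rightSubst n (g' : Matrix (Fin n) (Fin n) ℂ)) := by
      apply MvPolynomial.algHom_ext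
      intro v
      simp only [rightSubst, AlgHom.comp_apply, MvPolynomial.aeval_X, map_sum, map_mul,
        MvPolynomial.algHom_C, MvPolynomial.algebraMap_eq, Finset.mul_sum, Matrix.mul_apply,
        Finset.sum_mul]
      rw [Finset.sum_comm]
      exact Finset.sum_congr rfl fun _ _ => Finset.sum_congr rfl fun _ _ => by ring
    refine LinearMap.ext fun f => ?_
    simp [h]

/-- `S_n` acts on `ℂ[X]` by permuting the columns of `X`. -/
def columnPolyRep (n : ℕ) : Representation ℂ (Equiv.Perm (Fin n)) (PolyRing n) where
  toFun σ := (columnSubst n σ).toLinearMap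
  map_one' := by
    have h : columnSubst n 1 = AlgHom.id ℂ (PolyRing n) := by
      apply MvPolynomial.algHom_ext
      intro v
      simp [columnSubst]
    refine LinearMap.ext fun f => ?_
    simp [h]
  map_mul' σ τ := by
    have h : columnSubst n (σ * τ) = (columnSubst n σ).comp (columnSubst n τ) := by
      apply MvPolynomial.algHom_ext
      intro v
      simp [columnSubst]
    refine LinearMap.ext fun f => ?_
    simp [h]

/-- The action of `GL_n` on the degree `d` component of `R_n`. -/
def glRep (n d : ℕ) :
    Representation ℂ (Matrix.GeneralLinearGroup (Fin n) ℂ) (invariantComponent n d) :=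
  Subrepresentation.toRepresentation (ρ := glPolyRep n)
    { toSubmodule := invariantComponent n d
      apply_mem_toSubmodule := by
        intro g f hf
        rw [mem_invariantComponent] at hf ⊢
        refine ⟨fun A => ?_, ?_⟩
        · change leftSubst n _ (rightSubst n _ f) = rightSubst n _ f
          rw [leftSubst_rightSubst, hf.1 A]
        · change (rightSubst n _ f).IsHomogeneous (2 * d)
          rw [← one_mul (2 * d)]
          refine hf.2.aeval _ fun v => MvPolynomial.IsHomogeneous.sum _ _ _ fun k _ => ?_
          exact (MvPolynomial.isHomogeneous_X ℂ _).C_mul _ }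

/-- The action of `S_n`, by permutation of columns, on the degree `d` component of `R_n`. -/
def columnRep (n d : ℕ) : Representation ℂ (Equiv.Perm (Fin n)) (invariantComponent n d) :=
  Subrepresentation.toRepresentation (ρ := columnPolyRep n)
    { toSubmodule := invariantComponent n d
      apply_mem_toSubmodule := by
        intro σ f hf
        rw [mem_invariantComponent] at hf ⊢
        refine ⟨fun A => ?_, ?_⟩
        · change leftSubst n _ (columnSubst n σ f) = columnSubst n σ f
          rw [leftSubst_columnSubst, hf.1 A]
        · exact hf.2.rename_isHomogeneous }

/-! ### Symmetric functions in the variables `z_0, z_1, z_2, …` -/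

/-- Formal power series in infinitely many variables `z_0, z_1, z_2, …`, which contain the
symmetric functions with complex coefficients. -/
abbrev ZSeries : Type := MvPowerSeries ℕ ℂ

open Classical in
/-- The power sum `p_k = ∑_i z_i ^ k`, for `k ≥ 1`, given by its coefficients. -/
def powerSum (k : ℕ) : ZSeries :=
  fun m => if ∃ i : ℕ, m = Finsupp.single i k then 1 else 0

/-- The product `p_μ` of the power sums `p_{μ_i}` over the parts of `μ`. -/
def powerSumPart {n : ℕ} (μ : n.Partition) : ZSeries :=
  (μ.parts.map powerSum).prod

/-- The monomial `z^T = ∏_c z_{T(c)}` of a semistandard tableau `T`. -/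
def tableauMonomial {lam : YoungDiagram} (T : SemistandardYoungTableau lam) : MvPolynomial ℕ ℂ :=
  ∏ c ∈ lam.cells, MvPolynomial.X (T c.1 c.2)

/-- The Schur function `s_λ = ∑_T z^T`, over all semistandard tableaux `T` of shape `λ`. For each
monomial, only finitely many `T` contribute to its coefficient. -/
def schurFunction (lam : YoungDiagram) : ZSeries :=
  fun m => ∑ᶠ T : SemistandardYoungTableau lam, (tableauMonomial T).coeff m

/-- The value `s_λ(q_1, …, q_n)`: in `s_λ` the first `n` variables are set to the `q_i`, and all
others to `0`. Only the finitely many tableaux with entries among the first `n` contribute. -/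
def schurValue (lam : YoungDiagram) {n : ℕ} (q : Fin n → ℂ) : ℂ :=
  ∑ᶠ T : SemistandardYoungTableau lam,
    MvPolynomial.eval (fun i : ℕ => if h : i < n then q ⟨i, h⟩ else 0) (tableauMonomial T)

/-- The Young diagram of the partition `(d, d)`, with two rows of length `d`. -/
def twoRows (d : ℕ) : YoungDiagram where
  cells := Finset.range 2 ×ˢ Finset.range d
  isLowerSet := by
    intro a b hab ha
    have h1 : b.1 ≤ a.1 := hab.1
    have h2 : b.2 ≤ a.2 := hab.2
    simp only [Finset.coe_product, Finset.coe_range, Set.mem_prod, Set.mem_Iio] at ha ⊢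
    omega

/-- The polynomial `P` in indeterminates indexed by `k ≥ 1` is the expansion of `f` in power sums:
`f = P(p_1, p_2, p_3, …)`. -/
def IsPowerSumExpansion (P : MvPolynomial ℕ+ ℂ) (f : ZSeries) : Prop :=
  MvPolynomial.aeval (fun k : ℕ+ => powerSum (k : ℕ)) P = f

/-! ### Partitions and the Frobenius characteristic -/

/-- `z_μ = ∏_i i ^ {m_i} m_i!`, where `m_i` is the number of parts of `μ` equal to `i`. -/
def zPart {n : ℕ} (μ : n.Partition) : ℕ :=
  ∏ i ∈ μ.parts.toFinset, i ^ μ.parts.count i * (μ.parts.count i).factorial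

/-- `φ_k(μ)`, the sum of the parts of `μ` that divide `k`. -/
def dividingParts {n : ℕ} (μ : n.Partition) (k : ℕ) : ℕ :=
  (μ.parts.filter (fun a => a ∣ k)).sum

/-- The Frobenius characteristic of a representation of `S_n`: the symmetric function
`(1 / n!) ∑_σ χ(σ) p_{λ(σ)}`, where `λ(σ)` is the partition of cycle lengths of `σ` (with the
fixed points as parts `1`). -/
def frobeniusChar {n : ℕ} {V : Type*} [AddCommGroup V] [Module ℂ V]
    (ρ : Representation ℂ (Equiv.Perm (Fin n)) V) : ZSeries :=
  (n.factorial : ℂ)⁻¹ • ∑ σ : Equiv.Perm (Fin n), ρ.character σ • powerSumPart σ.partition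

end

end SLTwoInvariants

namespace SLTwoInvariants

noncomputable section

/-! A polynomial homogeneous of degree d in each of the two rows is SL_2-invariant exactly when the
raising operator E = ∑ x_j ∂/∂y_j kills it, since it is then a highest weight vector of weight 0
(`mem_invariantComponent_iff`). By sl_2 theory E maps bidegree (d, d) onto bidegree (d+1, d-1)
(`polarization_surjective`), and E commutes with column operations. This gives a GL_n-equivariant
exact sequence 0 → R_n^(d) → ℂ[X]_(d,d) → ℂ[X]_(d+1,d-1) → 0. Monomials are eigenvectors of diagonal
matrices, so the trace on R_n^(d) is h_d² - h_{d+1} h_{d-1} (`character_glRep_diagonal`).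

That difference is s_dd by Jacobi–Trudi (`schurFunction_twoRows`), proved coefficient by
coefficient: tableaux of content m correspond to ballot vectors (`bijOn_valueCount`), which a
telescoping induction on the number of variables counts (`ballotCount_eq`). Newton's identity then
expands s_dd in power sums, and the substitution z_i ↦ q_i T carries identities of series over to
values.

For S_n, permuting columns is the action of a permutation matrix, which is diagonalizable, so the
trace is s_dd at its eigenvalues. Their k-th power sum is the number of fixed points of σ^k, which
is φ_k of the cycle type (`card_fixed_pow`). Grouping permutations by cycle type, with n!/z_μ in
each class, yields the Frobenius characteristic. -/

/-! ### Polarization operators and bidegrees -/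

/-- The polarization operator `∑_j x_{p j} ∂/∂x_{q j}`. -/
def polarization (n : ℕ) (p q : Fin 2) : Derivation ℂ (PolyRing n) (PolyRing n) :=
  MvPolynomial.mkDerivation ℂ fun v => if v.1 = q then MvPolynomial.X (p, v.2) else 0

theorem polarization_X {n : ℕ} (p q : Fin 2) (v : Fin 2 × Fin n) :
    polarization n p q (MvPolynomial.X v) = if v.1 = q then MvPolynomial.X (p, v.2) else 0 := by
  simp [polarization]

/-- The degree of a monomial in the variables of row `p`. -/
def rowDegree {n : ℕ} (p : Fin 2) (s : Fin 2 × Fin n →₀ ℕ) : ℤ := ∑ j, (s (p, j) : ℤ)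

theorem rowDegree_add {n : ℕ} (p : Fin 2) (s t : Fin 2 × Fin n →₀ ℕ) :
    rowDegree p (s + t) = rowDegree p s + rowDegree p t := by
  simp [rowDegree, Finset.sum_add_distrib]

theorem rowDegree_single {n : ℕ} (p : Fin 2) (v : Fin 2 × Fin n) :
    rowDegree p (Finsupp.single v 1) = if v.1 = p then 1 else 0 := by
  obtain ⟨i, j⟩ := v
  by_cases h : i = p
  · subst h
    simp [rowDegree, Finsupp.single_apply]
  · simp [rowDegree, h]

theorem rowDegree_nonneg {n : ℕ} (p : Fin 2) (s : Fin 2 × Fin n →₀ ℕ) : 0 ≤ rowDegree p s :=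
  Finset.sum_nonneg fun _ _ => by positivity

theorem degree_eq_rowDegree {n : ℕ} (s : Fin 2 × Fin n →₀ ℕ) :
    (s.degree : ℤ) = rowDegree 0 s + rowDegree 1 s := by
  rw [Finsupp.degree_eq_sum, Fintype.sum_prod_type]
  simp [rowDegree]

/-- The monomials of row degrees `c 0` and `c 1`. -/
def bidegreeMonomials (n : ℕ) (c : Fin 2 → ℤ) : Set (Fin 2 × Fin n →₀ ℕ) :=
  {s | ∀ p, rowDegree p s = c p}

theorem finite_bidegreeMonomials (n : ℕ) (c : Fin 2 → ℤ) : (bidegreeMonomials n c).Finite := by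
  refine (Finsupp.finite_of_degree_le (c 0 + c 1).toNat).subset fun s hs => ?_
  have h := degree_eq_rowDegree s
  rw [hs 0, hs 1] at h
  simp only [Set.mem_ofPred_eq]
  omega

/-- The polynomials that are homogeneous of degree `c p` in the variables of row `p`. -/
def bidegreeSubmodule (n : ℕ) (c : Fin 2 → ℤ) : Submodule ℂ (PolyRing n) :=
  MvPolynomial.restrictSupport ℂ (bidegreeMonomials n c)

theorem mem_bidegreeSubmodule {n : ℕ} {c : Fin 2 → ℤ} {f : PolyRing n} :
    f ∈ bidegreeSubmodule n c ↔ ∀ s, f.coeff s ≠ 0 → ∀ p, rowDegree p s = c p := by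
  simp [bidegreeSubmodule, MvPolynomial.mem_restrictSupport_iff, Set.subset_def,
    bidegreeMonomials]

theorem monomial_mem_bidegreeSubmodule {n : ℕ} {c : Fin 2 → ℤ} {s : Fin 2 × Fin n →₀ ℕ}
    (hs : s ∈ bidegreeMonomials n c) (r : ℂ) :
    MvPolynomial.monomial s r ∈ bidegreeSubmodule n c :=
  (MvPolynomial.monomial_mem_restrictSupport ℂ).2 (Or.inl hs)

/-- A basis of the bihomogeneous polynomials: the monomials. -/
def bidegreeBasis (n : ℕ) (c : Fin 2 → ℤ) :
    Module.Basis (bidegreeMonomials n c) ℂ (bidegreeSubmodule n c) :=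
  MvPolynomial.basisRestrictSupport ℂ _

theorem coe_bidegreeBasis {n : ℕ} {c : Fin 2 → ℤ} (s : bidegreeMonomials n c) :
    (bidegreeBasis n c s : PolyRing n) = MvPolynomial.monomial (s : Fin 2 × Fin n →₀ ℕ) 1 := by
  have h : (bidegreeBasis n c).repr ⟨MvPolynomial.monomial (s : Fin 2 × Fin n →₀ ℕ) 1,
      monomial_mem_bidegreeSubmodule s.2 1⟩ = Finsupp.single s 1 := by
    ext t
    change MvPolynomial.coeff (t : Fin 2 × Fin n →₀ ℕ) (MvPolynomial.monomial _ 1) = _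
    simp [MvPolynomial.coeff_monomial, Finsupp.single_apply, Subtype.ext_iff]
  rw [← (bidegreeBasis n c).repr_symm_single_one, ← h, LinearEquiv.symm_apply_apply]

instance finite_bidegreeSubmodule (n : ℕ) (c : Fin 2 → ℤ) :
    Module.Finite ℂ (bidegreeSubmodule n c) :=
  have := (finite_bidegreeMonomials n c).to_subtype
  Module.Finite.of_basis (bidegreeBasis n c)

theorem bidegreeSubmodule_le {n : ℕ} {c : Fin 2 → ℤ} {P : Submodule ℂ (PolyRing n)}
    (h : ∀ s ∈ bidegreeMonomials n c, MvPolynomial.monomial s 1 ∈ P) :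
    bidegreeSubmodule n c ≤ P := by
  rw [bidegreeSubmodule, MvPolynomial.restrictSupport_eq_span, Submodule.span_le]
  rintro _ ⟨s, hs, rfl⟩
  exact h s hs

/-- Bidegrees are integers so that lowering past 0 lands in the zero space; this gives nilpotency of
the polarizations and covers the bidegree (1, -1) that occurs for d = 0. -/
theorem bidegreeSubmodule_eq_bot {n : ℕ} {c : Fin 2 → ℤ} {p : Fin 2} (h : c p < 0) :
    bidegreeSubmodule n c = ⊥ := by
  refine le_bot_iff.1 (bidegreeSubmodule_le fun s hs => ?_)
  have := rowDegree_nonneg p s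
  rw [hs p] at this
  omega

theorem polarization_monomial {n : ℕ} (p q : Fin 2) (s : Fin 2 × Fin n →₀ ℕ) :
    polarization n p q (MvPolynomial.monomial s 1) =
      ∑ v ∈ s.support, if v.1 = q then MvPolynomial.monomial
        (s - Finsupp.single v 1 + Finsupp.single (p, v.2) 1) (s v : ℂ) else 0 := by
  rw [polarization, MvPolynomial.mkDerivation_monomial, one_smul, Finsupp.sum]
  refine Finset.sum_congr rfl fun v _ => ?_
  split_ifs
  · rw [smul_eq_mul, MvPolynomial.X, MvPolynomial.monomial_mul, mul_one]
  · simp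

theorem polarization_mem {n : ℕ} {p q : Fin 2} {c : Fin 2 → ℤ} {f : PolyRing n}
    (hf : f ∈ bidegreeSubmodule n c) :
    polarization n p q f ∈ bidegreeSubmodule n (c + Pi.single p 1 - Pi.single q 1) := by
  suffices h : bidegreeSubmodule n c ≤ (bidegreeSubmodule n
      (c + Pi.single p 1 - Pi.single q 1)).comap (polarization n p q).toLinearMap from h hf
  refine bidegreeSubmodule_le fun s hs => ?_
  change polarization n p q (MvPolynomial.monomial s 1) ∈
    bidegreeSubmodule n (c + Pi.single p 1 - Pi.single q 1)
  rw [polarization_monomial]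
  refine Submodule.sum_mem _ fun v hv => ?_
  split_ifs with hq
  · refine monomial_mem_bidegreeSubmodule (fun i => ?_) _
    have hle : Finsupp.single v 1 ≤ s := by
      rw [Finsupp.single_le_iff]
      exact Nat.one_le_iff_ne_zero.2 (Finsupp.mem_support_iff.1 hv)
    have h := rowDegree_add i (s - Finsupp.single v 1) (Finsupp.single v 1)
    rw [tsub_add_cancel_of_le hle, hs i, rowDegree_single] at h
    rw [rowDegree_add, rowDegree_single]
    simp only [Pi.add_apply, Pi.sub_apply, Pi.single_apply, h, ← hq, eq_comm (a := i)]
    ring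
  · exact Submodule.zero_mem _

theorem polarization_self {n : ℕ} {p : Fin 2} {c : Fin 2 → ℤ} {f : PolyRing n}
    (hf : f ∈ bidegreeSubmodule n c) : polarization n p p f = (c p : ℂ) • f := by
  suffices h : bidegreeSubmodule n c ≤ LinearMap.ker
      ((polarization n p p).toLinearMap - (c p : ℂ) • LinearMap.id) by
    have h1 := h hf
    rwa [LinearMap.mem_ker, LinearMap.sub_apply, sub_eq_zero] at h1
  refine bidegreeSubmodule_le fun s hs => ?_
  rw [LinearMap.mem_ker, LinearMap.sub_apply, sub_eq_zero]
  change polarization n p p (MvPolynomial.monomial s 1) = (c p : ℂ) • MvPolynomial.monomial s 1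
  have hv : ∀ v ∈ s.support, (if v.1 = p then MvPolynomial.monomial
        (s - Finsupp.single v 1 + Finsupp.single (p, v.2) 1) (s v : ℂ) else 0) =
      MvPolynomial.monomial s (if v.1 = p then (s v : ℂ) else 0) := by
    intro v hv
    split_ifs with h
    · rw [← h, Prod.mk.eta, tsub_add_cancel_of_le]
      rw [Finsupp.single_le_iff]
      exact Nat.one_le_iff_ne_zero.2 (Finsupp.mem_support_iff.1 hv)
    · simp
  rw [polarization_monomial, Finset.sum_congr rfl hv, ← map_sum, MvPolynomial.smul_monomial,
    smul_eq_mul, mul_one]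
  congr 1
  rw [Finset.sum_subset (Finset.subset_univ _) fun v _ h => by
    simp [Finsupp.notMem_support_iff.1 h], Fintype.sum_prod_type, ← hs p, rowDegree]
  fin_cases p <;> simp

/-! ### The sl_2 relations and injectivity in positive weight. -/

theorem polarization_commutator {n : ℕ} {p q : Fin 2} (hpq : p ≠ q) (f : PolyRing n) :
    polarization n p q (polarization n q p f) - polarization n q p (polarization n p q f) =
      polarization n p p f - polarization n q q f := by
  have h : ⁅polarization n p q, polarization n q p⁆ = polarization n p p - polarization n q q := by
    refine MvPolynomial.derivation_ext fun v => ?_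
    simp only [Derivation.commutator_apply, Derivation.sub_apply, polarization_X]
    by_cases h1 : v.1 = p
    · have h2 : v.1 ≠ q := h1 ▸ hpq
      simp [h1, hpq, polarization_X]
    · by_cases h2 : v.1 = q
      · simp [h2, hpq.symm, polarization_X]
      · simp [h1, h2]
  simpa [Derivation.commutator_apply] using DFunLike.congr_fun h f

theorem iterate_polarization_mem {n : ℕ} {p q : Fin 2} {c : Fin 2 → ℤ} {f : PolyRing n}
    (hf : f ∈ bidegreeSubmodule n c) (i : ℕ) :
    ((polarization n p q).toLinearMap ^ i) f ∈
      bidegreeSubmodule n (c + (i : ℤ) • (Pi.single p 1 - Pi.single q 1)) := by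
  induction i with
  | zero => simpa using hf
  | succ i ih =>
    rw [pow_succ', Module.End.mul_apply]
    have h := polarization_mem (p := p) (q := q) ih
    convert! h using 2
    push_cast
    module

/-- If `E F w = 0` for a vector `w` of positive weight `k` in an `sl_2`-module on which `E` acts
nilpotently, then `w = 0`. -/
theorem eq_zero_of_raise_lower_eq_zero {V : Type*} [AddCommGroup V] [Module ℂ V]
    (E F : Module.End ℂ V) (w : V) {k : ℕ} (hk : 0 < k) {N : ℕ} (hN : (E ^ N) w = 0)
    (hcomm : ∀ i : ℕ, E (F ((E ^ i) w)) - F (E ((E ^ i) w)) = ((k + 2 * i : ℕ) : ℂ) • (E ^ i) w)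
    (h : E (F w) = 0) : w = 0 := by
  -- From E F w = 0 the commutator gives F E w = -k w. If F E^(i+1) w = -c E^i w, applying E and
  -- commuting again increases c by the weight k + 2(i+1) of E^(i+1) w, so the constants stay
  -- positive.
  have key : ∀ i : ℕ, ∃ c : ℕ, 0 < c ∧ F ((E ^ (i + 1)) w) = -((c : ℂ) • (E ^ i) w) := by
    intro i
    induction i with
    | zero =>
      refine ⟨k, hk, ?_⟩
      have h0 := hcomm 0
      simp only [pow_zero, Module.End.one_apply, h, zero_sub, mul_zero, add_zero] at h0
      simp [← h0]
    | succ i ih =>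
      obtain ⟨c, hc, hF⟩ := ih
      refine ⟨c + (k + 2 * (i + 1)), by omega, ?_⟩
      have h1 := hcomm (i + 1)
      rw [hF, map_neg, map_smul, ← Module.End.mul_apply E (E ^ i), ← pow_succ',
        ← Module.End.mul_apply E (E ^ (i + 1)), ← pow_succ'] at h1
      rw [← sub_eq_zero] at h1 ⊢
      rw [← neg_eq_zero, ← h1]
      push_cast
      module
  -- Descent: if E^(N+1) w = 0, then `key` makes a positive multiple of E^N w vanish.
  induction N with
  | zero => simpa using hN
  | succ N ih =>
    obtain ⟨c, hc, hF⟩ := key N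
    rw [hN, map_zero] at hF
    refine ih ((smul_eq_zero.1 (neg_eq_zero.1 hF.symm)).resolve_left ?_)
    exact_mod_cast hc.ne'

theorem eq_zero_of_polarization_polarization_eq_zero {n : ℕ} {p q : Fin 2} (hpq : p ≠ q)
    {c : Fin 2 → ℤ} {w : PolyRing n} (hw : w ∈ bidegreeSubmodule n c) (hc : c q < c p)
    (h : polarization n p q (polarization n q p w) = 0) : w = 0 := by
  refine eq_zero_of_raise_lower_eq_zero (polarization n p q).toLinearMap
    (polarization n q p).toLinearMap w (k := (c p - c q).toNat) (by omega)
    -- Each raising takes one from the degree in row q, so `(c q).toNat + 1` of them make it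
    -- negative.
    (N := (c q).toNat + 1) ?_ (fun i => ?_) h
  · have h1 := iterate_polarization_mem (p := p) (q := q) hw ((c q).toNat + 1)
    rwa [bidegreeSubmodule_eq_bot (p := q), Submodule.mem_bot] at h1
    simp [hpq.symm]
    omega
  · have h1 := iterate_polarization_mem (p := p) (q := q) hw i
    refine (polarization_commutator hpq _).trans ?_
    rw [polarization_self h1, polarization_self h1, ← sub_smul]
    congr 1
    have h2 : (((c p - c q).toNat : ℕ) : ℤ) = c p - c q := by omega
    have h3 : (((c p - c q).toNat : ℕ) : ℂ) = c p - c q := by exact_mod_cast h2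
    simp [hpq, hpq.symm, h3]
    ring

/-! ### Invariants as highest weight vectors -/

/-- The substitution that adds `T` times row `p` to row `q`, with a new indeterminate `T`. -/
def shear (n : ℕ) (p q : Fin 2) : PolyRing n →ₐ[ℂ] Polynomial (PolyRing n) :=
  MvPolynomial.aeval fun v => Polynomial.C (MvPolynomial.X v) +
    if v.1 = q then Polynomial.X * Polynomial.C (MvPolynomial.X (p, v.2)) else 0

theorem shear_X {n : ℕ} (p q : Fin 2) (v : Fin 2 × Fin n) :
    shear n p q (MvPolynomial.X v) = Polynomial.C (MvPolynomial.X v) +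
      if v.1 = q then Polynomial.X * Polynomial.C (MvPolynomial.X (p, v.2)) else 0 := by
  simp [shear]

theorem shear_C {n : ℕ} (p q : Fin 2) (a : ℂ) :
    shear n p q (MvPolynomial.C a) = Polynomial.C (MvPolynomial.C a) := by
  simp [shear, Polynomial.algebraMap_apply, MvPolynomial.algebraMap_eq]

theorem leftSubst_X {n : ℕ} (A : Matrix (Fin 2) (Fin 2) ℂ) (v : Fin 2 × Fin n) :
    leftSubst n A (MvPolynomial.X v) =
      ∑ k, MvPolynomial.C (A v.1 k) * MvPolynomial.X (k, v.2) := by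
  simp [leftSubst]

theorem leftSubst_C {n : ℕ} (A : Matrix (Fin 2) (Fin 2) ℂ) (a : ℂ) :
    leftSubst n A (MvPolynomial.C a) = MvPolynomial.C a := by
  simp [leftSubst, MvPolynomial.algebraMap_eq]

theorem eval_shear {n : ℕ} {p q : Fin 2} (t : ℂ) (f : PolyRing n) :
    (shear n p q f).eval (MvPolynomial.C t) = leftSubst n (Matrix.transvection q p t) f := by
  induction f using MvPolynomial.induction_on with
  | C a => rw [shear_C, leftSubst_C, Polynomial.eval_C]
  | add f g hf hg => simp [hf, hg]
  | mul_X f v hf =>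
    rw [map_mul, Polynomial.eval_mul, hf, map_mul, shear_X, leftSubst_X]
    obtain ⟨i, j⟩ := v
    congr 1
    simp only [Matrix.transvection, Matrix.add_apply, Matrix.one_apply, Matrix.single_apply,
      map_add, add_mul, Finset.sum_add_distrib]
    by_cases h : i = q
    · simp [h, apply_ite MvPolynomial.C]
      ring
    · simp [h, Ne.symm h, apply_ite MvPolynomial.C]

/-- The shear is exp(T E), with E the polarization. For p ≠ q the added row is itself unchanged, so
differentiating in T inserts one E. -/
theorem derivative_shear {n : ℕ} {p q : Fin 2} (hpq : p ≠ q) (f : PolyRing n) :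
    Polynomial.derivative (shear n p q f) = shear n p q (polarization n p q f) := by
  induction f using MvPolynomial.induction_on with
  | C a => rw [shear_C, MvPolynomial.derivation_C, map_zero, Polynomial.derivative_C]
  | add f g hf hg => simp [hf, hg]
  | mul_X f v hf =>
    rw [map_mul, Polynomial.derivative_mul, hf, Derivation.leibniz, polarization_X, shear_X]
    split_ifs with h
    · simp [shear_X, h, hpq]
      ring
    · simp [shear_X, h]
      ring

/-- Passage from the group to the Lie algebra: invariance under all transvections means that the
shear is constant in T, which in characteristic 0 means that its derivative vanishes. -/
theorem leftSubst_transvection_iff {n : ℕ} {p q : Fin 2} (hpq : p ≠ q) (f : PolyRing n) :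
    (∀ t : ℂ, leftSubst n (Matrix.transvection q p t) f = f) ↔ polarization n p q f = 0 := by
  have h0 : ∀ g : PolyRing n, (shear n p q g).eval 0 = g := by
    intro g
    have h := eval_shear (p := p) (q := q) 0 g
    rw [map_zero] at h
    rw [h, Matrix.transvection_zero]
    have h1 : leftSubst n 1 = AlgHom.id ℂ (PolyRing n) := by
      refine MvPolynomial.algHom_ext fun v => ?_
      simp [leftSubst_X, Matrix.one_apply, apply_ite MvPolynomial.C]
    rw [h1, AlgHom.id_apply]
  constructor
  · intro h
    have h1 : shear n p q f = Polynomial.C f := by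
      -- The shear takes the value f at every constant t, and these are infinitely many points of
      -- the coefficient domain.
      refine Polynomial.eq_of_infinite_eval_eq _ _ ?_
      refine (Set.infinite_range_of_injective (MvPolynomial.C_injective (Fin 2 × Fin n) ℂ)).mono ?_
      rintro _ ⟨t, rfl⟩
      simp [eval_shear, h]
    rw [← h0 (polarization n p q f), ← derivative_shear hpq, h1]
    simp
  · intro h t
    have h1 := derivative_shear hpq f
    rw [h, map_zero] at h1
    have h2 := Polynomial.eq_C_of_derivative_eq_zero h1
    rw [← eval_shear, h2, Polynomial.eval_C, Polynomial.coeff_zero_eq_eval_zero, h0]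

/-- The order reverses: substituting B X for X in f(A X) gives f(A B X). -/
theorem leftSubst_mul {n : ℕ} (A B : Matrix (Fin 2) (Fin 2) ℂ) (f : PolyRing n) :
    leftSubst n (A * B) f = leftSubst n B (leftSubst n A f) := by
  have h : leftSubst n (A * B) = (leftSubst n B).comp (leftSubst n A) := by
    refine MvPolynomial.algHom_ext fun v => ?_
    simp only [AlgHom.comp_apply, leftSubst_X, map_sum, map_mul, leftSubst_C, Matrix.mul_apply,
      Finset.mul_sum, Finset.sum_mul]
    rw [Finset.sum_comm]
    simp only [mul_assoc]
  exact DFunLike.congr_fun h f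

/-- A polynomial fixed by both kinds of transvections is fixed by `SL_2`. -/
theorem leftSubst_eq_self_of_transvection {n : ℕ} {f : PolyRing n}
    (hf : ∀ p q : Fin 2, p ≠ q → ∀ t : ℂ, leftSubst n (Matrix.transvection q p t) f = f)
    (A : Matrix.SpecialLinearGroup (Fin 2) ℂ) :
    leftSubst n (A : Matrix (Fin 2) (Fin 2) ℂ) f = f := by
  have key : ∀ M : Matrix (Fin 2) (Fin 2) ℂ, M.det = 1 → M 1 0 ≠ 0 → leftSubst n M f = f := by
    intro M hM hc
    have hdec : M = Matrix.transvection 0 1 ((M 0 0 - 1) / M 1 0) *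
        Matrix.transvection 1 0 (M 1 0) * Matrix.transvection 0 1 ((M 1 1 - 1) / M 1 0) := by
      rw [Matrix.det_fin_two] at hM
      ext i j
      fin_cases i <;> fin_cases j <;>
        simp [Matrix.transvection, Matrix.mul_apply, Matrix.one_apply, Matrix.single_apply] <;>
        field_simp <;> first | ring1 | linear_combination -hM
    rw [hdec, leftSubst_mul, leftSubst_mul, hf 1 0 (by decide), hf 0 1 (by decide),
      hf 1 0 (by decide)]
  by_cases hc : (A : Matrix (Fin 2) (Fin 2) ℂ) 1 0 = 0
  -- When the lower left entry vanishes, the upper left one does not; adding row 0 to row 1 reduces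
  -- to the previous case.
  · have hdet := A.det_coe
    have h1 := key (Matrix.transvection 1 0 1 * (A : Matrix (Fin 2) (Fin 2) ℂ)) (by
      rw [Matrix.det_mul, hdet, Matrix.det_transvection_of_ne _ _ (by decide), one_mul]) (by
      rw [Matrix.det_fin_two, hc] at hdet
      have : (A : Matrix (Fin 2) (Fin 2) ℂ) 0 0 ≠ 0 := by
        intro h
        simp [h] at hdet
      simpa [Matrix.transvection, Matrix.mul_apply, Matrix.one_apply, Matrix.single_apply, hc])
    rwa [leftSubst_mul, hf 0 1 (by decide)] at h1
  · exact key _ A.det_coe hc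

theorem leftSubst_diagonal_monomial {n : ℕ} (a : Fin 2 → ℂ) (s : Fin 2 × Fin n →₀ ℕ) (r : ℂ) :
    leftSubst n (Matrix.diagonal a) (MvPolynomial.monomial s r) =
      (∏ v, a v.1 ^ s v) • MvPolynomial.monomial s r := by
  rw [leftSubst, MvPolynomial.aeval_monomial, Finsupp.prod_fintype _ _ (fun _ => pow_zero _),
    MvPolynomial.monomial_eq, Finsupp.prod_fintype _ _ (fun _ => pow_zero _),
    MvPolynomial.algebraMap_eq]
  have h : ∀ v : Fin 2 × Fin n, ∑ k, MvPolynomial.C (Matrix.diagonal a v.1 k) *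
      (MvPolynomial.X (k, v.2) : PolyRing n) = MvPolynomial.C (a v.1) * MvPolynomial.X v := by
    intro v
    simp [Matrix.diagonal_apply, apply_ite MvPolynomial.C]
  simp only [h, mul_pow, Finset.prod_mul_distrib, MvPolynomial.smul_eq_C_mul, map_prod, map_pow]
  ring

theorem coeff_leftSubst_diagonal {n : ℕ} (a : Fin 2 → ℂ) (s : Fin 2 × Fin n →₀ ℕ)
    (f : PolyRing n) :
    (leftSubst n (Matrix.diagonal a) f).coeff s = (∏ v, a v.1 ^ s v) * f.coeff s := by
  induction f using MvPolynomial.induction_on' with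
  | monomial t r =>
    rw [leftSubst_diagonal_monomial, MvPolynomial.coeff_smul, MvPolynomial.coeff_monomial]
    split_ifs with h
    · rw [h, smul_eq_mul]
    · simp
  | add f g hf hg => simp [hf, hg, mul_add]

theorem weight_one_eq_degree {σ : Type*} (s : σ →₀ ℕ) : Finsupp.weight 1 s = s.degree :=
  (DFunLike.congr_fun (Finsupp.degree_eq_weight_one (σ := σ) (R := ℕ)) s).symm

/-- Torus invariance forces equal row degrees and unipotent invariance forces E f = 0. Conversely a
weight 0 vector killed by E is also killed by the lowering operator, hence fixed by both kinds of
transvections, which generate SL_2. -/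
theorem mem_invariantComponent_iff {n d : ℕ} {f : PolyRing n} :
    f ∈ invariantComponent n d ↔
      f ∈ bidegreeSubmodule n (fun _ => d) ∧ polarization n 0 1 f = 0 := by
  rw [mem_invariantComponent]
  constructor
  · rintro ⟨h1, h2⟩
    constructor
    · rw [mem_bidegreeSubmodule]
      intro s hs
      have hdeg : (s.degree : ℤ) = 2 * d := by
        have := h2 hs
        rw [weight_one_eq_degree] at this
        exact_mod_cast this
      -- The single element diag(2, 1/2) suffices: it scales a monomial by 2 to the difference of
      -- its row degrees, and 2 is not a root of unity.
      have h3 := congrArg (MvPolynomial.coeff s) (h1 ⟨Matrix.diagonal ![2, 2⁻¹], by simp⟩)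
      simp only [coeff_leftSubst_diagonal] at h3
      have h4 : (∏ v : Fin 2 × Fin n, (![2, 2⁻¹] : Fin 2 → ℂ) v.1 ^ s v) =
          2 ^ (rowDegree 0 s - rowDegree 1 s) := by
        rw [Fintype.prod_prod_type, zpow_sub₀ two_ne_zero]
        simp only [Fin.prod_univ_two, Matrix.cons_val_zero, Matrix.cons_val_one,
          Finset.prod_pow_eq_pow_sum, rowDegree, ← Nat.cast_sum, zpow_natCast, inv_pow,
          div_eq_mul_inv]
      rw [h4] at h3
      have h5 : (2 : ℂ) ^ (rowDegree 0 s - rowDegree 1 s) = 1 :=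
        mul_right_cancel₀ hs (by rw [h3, one_mul])
      have h6 : (2 : ℝ) ^ (rowDegree 0 s - rowDegree 1 s) = 1 := by
        simpa using congrArg (fun z : ℂ => ‖z‖) h5
      have h7 : rowDegree 0 s - rowDegree 1 s = 0 :=
        (zpow_eq_one_iff_right₀ (by norm_num) (by norm_num)).1 h6
      rw [degree_eq_rowDegree] at hdeg
      intro p
      fin_cases p <;> simp <;> omega
    · rw [← leftSubst_transvection_iff (by decide)]
      exact fun t => h1 ⟨_, Matrix.det_transvection_of_ne _ _ (by decide) t⟩
  · rintro ⟨h1, h2⟩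
    have h3 : polarization n 1 0 f = 0 := by
      -- With the rows exchanged, F f has weight 2 > 0. Since f has weight 0, E F f = F E f = 0, so
      -- F E (F f) = 0 and the injectivity lemma gives F f = 0.
      refine eq_zero_of_polarization_polarization_eq_zero (p := 1) (q := 0) (by decide)
        (polarization_mem h1) (by simp) ?_
      have h3 := polarization_commutator (p := 0) (q := 1) (by decide) f
      rw [h2, map_zero, sub_zero, polarization_self h1, polarization_self h1, sub_self] at h3
      rw [h3, map_zero]
    constructor
    · refine leftSubst_eq_self_of_transvection fun p q hpq => ?_
      rw [leftSubst_transvection_iff hpq]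
      fin_cases p <;> fin_cases q <;> simp_all
    · intro s hs
      have h4 := degree_eq_rowDegree s
      rw [mem_bidegreeSubmodule.1 h1 s hs, mem_bidegreeSubmodule.1 h1 s hs] at h4
      rw [weight_one_eq_degree]
      omega

/-! ### The trace on the invariants -/

/-- A linear splitting, not assumed equivariant, writes `DV` as a part factoring through `K` plus a
part factoring through `W`; cyclicity of the trace moves each to its own space. -/
theorem trace_eq_trace_add_trace_of_exact {V W K : Type*} [AddCommGroup V] [Module ℂ V]
    [AddCommGroup W] [Module ℂ W] [AddCommGroup K] [Module ℂ K] [Module.Finite ℂ V]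
    [Module.Finite ℂ W] [Module.Finite ℂ K] {i : K →ₗ[ℂ] V} {e : V →ₗ[ℂ] W}
    (hi : Function.Injective i) (hie : Function.Exact i e) (he : Function.Surjective e)
    {DK : K →ₗ[ℂ] K} {DV : V →ₗ[ℂ] V} {DW : W →ₗ[ℂ] W} (hDK : DV ∘ₗ i = i ∘ₗ DK)
    (hDW : e ∘ₗ DV = DW ∘ₗ e) :
    LinearMap.trace ℂ V DV = LinearMap.trace ℂ K DK + LinearMap.trace ℂ W DW := by
  obtain ⟨s, hs⟩ := e.exists_rightInverse_of_surjective (LinearMap.range_eq_top.2 he)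
  obtain ⟨r, hr⟩ := i.exists_leftInverse_of_injective (LinearMap.ker_eq_bot.2 hi)
  set P : V →ₗ[ℂ] K := r ∘ₗ (LinearMap.id - s ∘ₗ e) with hP
  have hs' : ∀ w, e (s w) = w := fun w => LinearMap.congr_fun hs w
  have hr' : ∀ k, r (i k) = k := fun k => LinearMap.congr_fun hr k
  have hei : ∀ k, e (i k) = 0 := fun k => hie.apply_apply_eq_zero k
  have h1 : DV = (DV ∘ₗ i) ∘ₗ P + (DV ∘ₗ s) ∘ₗ e := by
    refine LinearMap.ext fun v => ?_
    obtain ⟨k, hk⟩ := (hie (v - s (e v))).1 (by simp [hs'])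
    simp only [hP, LinearMap.add_apply, LinearMap.comp_apply, LinearMap.sub_apply,
      LinearMap.id_apply, ← hk, hr']
    rw [hk, map_sub, sub_add_cancel]
  have h2 : P ∘ₗ i = LinearMap.id := by
    refine LinearMap.ext fun k => ?_
    simp [hP, hei, hr']
  conv_lhs => rw [h1]
  rw [map_add, LinearMap.trace_comp_comm', LinearMap.trace_comp_comm' e (DV ∘ₗ s), hDK,
    ← LinearMap.comp_assoc, h2, LinearMap.id_comp, ← LinearMap.comp_assoc, hDW,
    LinearMap.comp_assoc, hs, LinearMap.comp_id]

/-- The value `h_j(q_1, …, q_n)` of the complete homogeneous symmetric polynomial; it is `0` for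
negative `j`. -/
def completeValue {n : ℕ} (q : Fin n → ℂ) (j : ℤ) : ℂ :=
  ∑ᶠ (a : Fin n →₀ ℕ) (_ : a ∈ {a : Fin n →₀ ℕ | (a.degree : ℤ) = j}), ∏ i, q i ^ a i

theorem finite_degree_eq (n : ℕ) (j : ℤ) : {a : Fin n →₀ ℕ | (a.degree : ℤ) = j}.Finite := by
  refine (Finsupp.finite_of_degree_le j.toNat).subset fun a ha => ?_
  simp only [Set.mem_ofPred_eq] at ha ⊢
  omega

theorem completeValue_eq_sum {n : ℕ} (q : Fin n → ℂ) (j : ℤ) :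
    completeValue q j = ∑ a ∈ (finite_degree_eq n j).toFinset, ∏ i, q i ^ a i :=
  finsum_mem_eq_finite_toFinset_sum _ _

theorem sum_bidegreeMonomials {n : ℕ} (q : Fin n → ℂ) (c : Fin 2 → ℤ) :
    ∑ s ∈ (finite_bidegreeMonomials n c).toFinset, ∏ v, q v.2 ^ s v =
      completeValue q (c 0) * completeValue q (c 1) := by
  rw [completeValue_eq_sum, completeValue_eq_sum, Finset.sum_mul_sum, ← Finset.sum_product']
  refine Finset.sum_nbij'
    (fun s => (Finsupp.equivFunOnFinite.symm fun j => s (0, j),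
      Finsupp.equivFunOnFinite.symm fun j => s (1, j)))
    (fun a => Finsupp.equivFunOnFinite.symm fun v => if v.1 = 0 then a.1 v.2 else a.2 v.2)
    ?_ ?_ ?_ ?_ ?_
  · intro s hs
    simp only [Set.Finite.mem_toFinset, bidegreeMonomials, Set.mem_ofPred_eq, rowDegree] at hs
    simp [Finsupp.degree_eq_sum, hs]
  · intro a ha
    simp only [Finset.mem_product, Set.Finite.mem_toFinset, Set.mem_ofPred_eq,
      Finsupp.degree_eq_sum] at ha
    simp only [Set.Finite.mem_toFinset, bidegreeMonomials, Set.mem_ofPred_eq, rowDegree]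
    intro p
    fin_cases p
    · simpa using ha.1
    · simpa using ha.2
  · intro s _
    ext ⟨p, j⟩
    fin_cases p <;> simp
  · intro a _
    ext j <;> simp
  · intro s _
    simp [Fintype.prod_prod_type]

theorem rightSubst_diagonal_monomial {n : ℕ} (q : Fin n → ℂ) (s : Fin 2 × Fin n →₀ ℕ) (r : ℂ) :
    rightSubst n (Matrix.diagonal q) (MvPolynomial.monomial s r) =
      (∏ v, q v.2 ^ s v) • MvPolynomial.monomial s r := by
  rw [rightSubst, MvPolynomial.aeval_monomial, Finsupp.prod_fintype _ _ (fun _ => pow_zero _),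
    MvPolynomial.monomial_eq, Finsupp.prod_fintype _ _ (fun _ => pow_zero _),
    MvPolynomial.algebraMap_eq]
  have h : ∀ v : Fin 2 × Fin n, ∑ k, MvPolynomial.C (Matrix.diagonal q k v.2) *
      (MvPolynomial.X (v.1, k) : PolyRing n) = MvPolynomial.C (q v.2) * MvPolynomial.X v := by
    intro v
    simp [Matrix.diagonal_apply, apply_ite MvPolynomial.C]
  simp only [h, mul_pow, Finset.prod_mul_distrib, MvPolynomial.smul_eq_C_mul, map_prod, map_pow]
  ring

theorem rightSubst_diagonal_mem {n : ℕ} (q : Fin n → ℂ) (c : Fin 2 → ℤ) :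
    ∀ f ∈ bidegreeSubmodule n c, (rightSubst n (Matrix.diagonal q)).toLinearMap f ∈
      bidegreeSubmodule n c := by
  have h : bidegreeSubmodule n c ≤
      (bidegreeSubmodule n c).comap (rightSubst n (Matrix.diagonal q)).toLinearMap := by
    refine bidegreeSubmodule_le fun s hs => ?_
    rw [Submodule.mem_comap, AlgHom.toLinearMap_apply, rightSubst_diagonal_monomial]
    exact Submodule.smul_mem _ _ (monomial_mem_bidegreeSubmodule hs 1)
  exact fun f hf => h hf

/-- The monomials form an eigenbasis, and a monomial is a free choice of one monomial in each row,
whence the product of two complete homogeneous values. -/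
theorem trace_diagonal_bidegreeSubmodule {n : ℕ} (q : Fin n → ℂ) (c : Fin 2 → ℤ) :
    LinearMap.trace ℂ (bidegreeSubmodule n c)
      ((rightSubst n (Matrix.diagonal q)).toLinearMap.restrict (rightSubst_diagonal_mem q c)) =
      completeValue q (c 0) * completeValue q (c 1) := by
  classical
  have := (finite_bidegreeMonomials n c).fintype
  rw [← sum_bidegreeMonomials, LinearMap.trace_eq_matrix_trace ℂ (bidegreeBasis n c),
    Matrix.trace, Finset.sum_subtype (p := (· ∈ bidegreeMonomials n c)) _ (fun s => by simp)]
  refine Finset.sum_congr rfl fun s _ => ?_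
  have h : (rightSubst n (Matrix.diagonal q)).toLinearMap.restrict (rightSubst_diagonal_mem q c)
      (bidegreeBasis n c s) = (∏ v, q v.2 ^ s.1 v) • bidegreeBasis n c s := by
    refine Subtype.ext ?_
    rw [LinearMap.coe_restrict_apply, AlgHom.toLinearMap_apply, Submodule.coe_smul,
      coe_bidegreeBasis, rightSubst_diagonal_monomial]
  rw [Matrix.diag_apply, LinearMap.toMatrix_apply, h, map_smul]
  simp

/-! ### The equivariant exact sequence. -/

theorem polarization_rightSubst {n : ℕ} (p q : Fin 2) (g : Matrix (Fin n) (Fin n) ℂ)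
    (f : PolyRing n) :
    polarization n p q (rightSubst n g f) = rightSubst n g (polarization n p q f) := by
  induction f using MvPolynomial.induction_on with
  | C a => simp [rightSubst, MvPolynomial.algebraMap_eq, MvPolynomial.derivation_C]
  | add f g hf hg => simp [hf, hg]
  | mul_X f v hf =>
    have hX : ∀ w : Fin 2 × Fin n, rightSubst n g (MvPolynomial.X w) =
        ∑ k, MvPolynomial.C (g k w.2) * MvPolynomial.X (w.1, k) := by
      simp [rightSubst]
    rw [map_mul, Derivation.leibniz, hf, Derivation.leibniz, map_add, smul_eq_mul, smul_eq_mul,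
      smul_eq_mul, smul_eq_mul, map_mul, map_mul]
    congr 2
    rw [hX, map_sum, polarization_X, apply_ite (rightSubst n g), map_zero, hX]
    have hC : ∀ k, polarization n p q (MvPolynomial.C (g k v.2) * MvPolynomial.X (v.1, k)) =
        MvPolynomial.C (g k v.2) * if v.1 = q then MvPolynomial.X (p, k) else 0 := by
      intro k
      rw [MvPolynomial.C_mul', MvPolynomial.C_mul', Derivation.map_smul, polarization_X]
    simp only [hC]
    split_ifs <;> simp

/-- On the target, of weight c p - c q + 2 > 0, the composite E F is injective, hence bijective by
finite dimension. So w = E (F u) for some u. -/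
theorem polarization_surjective {n : ℕ} {p q : Fin 2} (hpq : p ≠ q) {c : Fin 2 → ℤ}
    (hc : c q ≤ c p) {w : PolyRing n}
    (hw : w ∈ bidegreeSubmodule n (c + Pi.single p 1 - Pi.single q 1)) :
    ∃ f ∈ bidegreeSubmodule n c, polarization n p q f = w := by
  have hmem : ∀ w ∈ bidegreeSubmodule n (c + Pi.single p 1 - Pi.single q 1),
      polarization n q p w ∈ bidegreeSubmodule n c := by
    intro w hw
    have h := polarization_mem (p := q) (q := p) hw
    convert! h using 2
    abel
  set T : Module.End ℂ (bidegreeSubmodule n (c + Pi.single p 1 - Pi.single q 1)) :=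
    ((polarization n p q).toLinearMap ∘ₗ (polarization n q p).toLinearMap).restrict
      (fun w hw => polarization_mem (hmem w hw)) with hT
  have hinj : Function.Injective T := by
    refine (injective_iff_map_eq_zero T).2 fun w h => Subtype.ext ?_
    refine eq_zero_of_polarization_polarization_eq_zero hpq w.2 ?_ (congrArg Subtype.val h)
    simp [hpq, hpq.symm]
    omega
  obtain ⟨u, hu⟩ := LinearMap.injective_iff_surjective.1 hinj ⟨w, hw⟩
  exact ⟨polarization n q p u, hmem u u.2, congrArg Subtype.val hu⟩

instance finite_invariantComponent (n d : ℕ) : Module.Finite ℂ (invariantComponent n d) := by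
  have h : invariantComponent n d ≤ bidegreeSubmodule n fun _ => (d : ℤ) :=
    fun f hf => (mem_invariantComponent_iff.1 hf).1
  exact Module.Finite.of_injective (Submodule.inclusion h) (Submodule.inclusion_injective h)

/-- The invariants are the kernel of E on bidegree (d, d), so their trace is that of bidegree (d, d)
minus that of bidegree (d+1, d-1). -/
theorem character_glRep_diagonal {n d : ℕ} {g : Matrix.GeneralLinearGroup (Fin n) ℂ}
    {q : Fin n → ℂ} (hg : (g : Matrix (Fin n) (Fin n) ℂ) = Matrix.diagonal q) :
    (glRep n d).character g = completeValue q d * completeValue q d -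
      completeValue q (d + 1) * completeValue q (d - 1) := by
  set c : Fin 2 → ℤ := fun _ => (d : ℤ) with hc
  have hle : invariantComponent n d ≤ bidegreeSubmodule n c :=
    fun f hf => (mem_invariantComponent_iff.1 hf).1
  have h := trace_eq_trace_add_trace_of_exact (i := Submodule.inclusion hle)
    (e := (polarization n 0 1).toLinearMap.restrict
      (q := bidegreeSubmodule n (c + Pi.single 0 1 - Pi.single 1 1))
      (fun f hf => polarization_mem hf))
    (DK := glRep n d g)
    (DV := (rightSubst n (Matrix.diagonal q)).toLinearMap.restrict (rightSubst_diagonal_mem q c))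
    (DW := (rightSubst n (Matrix.diagonal q)).toLinearMap.restrict (rightSubst_diagonal_mem q _))
    (Submodule.inclusion_injective hle) ?_ ?_ ?_ ?_
  · rw [trace_diagonal_bidegreeSubmodule, trace_diagonal_bidegreeSubmodule] at h
    rw [Representation.character, eq_sub_iff_add_eq]
    simpa [hc] using h.symm
  · intro f
    constructor
    · intro hf
      exact ⟨⟨f, mem_invariantComponent_iff.2 ⟨f.2, congrArg Subtype.val hf⟩⟩, rfl⟩
    · rintro ⟨f, rfl⟩
      exact Subtype.ext (mem_invariantComponent_iff.1 f.2).2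
  · rintro ⟨w, hw⟩
    obtain ⟨f, hf, hfw⟩ := polarization_surjective (p := 0) (q := 1) (by decide) le_rfl hw
    exact ⟨⟨f, hf⟩, Subtype.ext hfw⟩
  · refine LinearMap.ext fun f => Subtype.ext ?_
    change rightSubst n (Matrix.diagonal q) f = rightSubst n g f
    rw [hg]
  · exact LinearMap.ext fun f => Subtype.ext (polarization_rightSubst 0 1 _ _)

/-! ### Ballot vectors -/

open Classical in
/-- The vectors `a` with `a ≤ m` and with `a i = 0` for `i ≥ n`. -/
def boundedVectors (m : ℕ → ℕ) : ℕ → Finset (ℕ → ℕ)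
  | 0 => {0}
  | n + 1 => (boundedVectors m n ×ˢ Finset.range (m n + 1)).image
      fun p => Function.update p.1 n p.2

theorem mem_boundedVectors {m : ℕ → ℕ} {n : ℕ} {a : ℕ → ℕ} :
    a ∈ boundedVectors m n ↔ (∀ i, a i ≤ m i) ∧ ∀ i, n ≤ i → a i = 0 := by
  induction n generalizing a with
  | zero =>
    simp only [boundedVectors, Finset.mem_singleton, Nat.zero_le, true_imp_iff]
    exact ⟨by rintro rfl; simp, fun h => funext h.2⟩
  | succ n ih =>
    simp only [boundedVectors, Finset.mem_image, Finset.mem_product, Finset.mem_range, Prod.exists,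
      ih]
    constructor
    · rintro ⟨b, t, ⟨⟨h1, h2⟩, ht⟩, rfl⟩
      refine ⟨fun i => ?_, fun i hi => ?_⟩
      · by_cases h : i = n
        · subst h
          rw [Function.update_self]
          omega
        · simpa [h] using h1 i
      · rw [Function.update_of_ne (by omega), h2 i (by omega)]
    · rintro ⟨h1, h2⟩
      refine ⟨Function.update a n 0, a n, ⟨⟨fun i => ?_, fun i hi => ?_⟩, ?_⟩, by simp⟩
      · by_cases h : i = n
        · simp [h]
        · simpa [h] using h1 i
      · by_cases h : i = n
        · simp [h]
        · rw [Function.update_of_ne h, h2 i (by omega)]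
      · have := h1 n
        omega

theorem sum_boundedVectors_succ (m : ℕ → ℕ) (n : ℕ) (g : (ℕ → ℕ) → ℤ) :
    ∑ a ∈ boundedVectors m (n + 1), g a =
      ∑ t ∈ Finset.range (m n + 1), ∑ a ∈ boundedVectors m n, g (Function.update a n t) := by
  classical
  rw [boundedVectors, Finset.sum_image, Finset.sum_product_right]
  rintro ⟨a, t⟩ ha ⟨b, u⟩ hb h
  simp only [Finset.coe_product, Set.mem_prod, Finset.mem_coe] at ha hb h
  have h1 : t = u := by simpa using congrFun h n
  have h2 : a = b := by
    funext i
    by_cases hi : i = n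
    · rw [hi, (mem_boundedVectors.1 ha.1).2 n le_rfl, (mem_boundedVectors.1 hb.1).2 n le_rfl]
    · simpa [hi] using congrFun h i
  rw [h1, h2]

/-- The sum of the first `v` entries of `a`. -/
def prefixSum (a : ℕ → ℕ) (v : ℕ) : ℕ := ∑ i ∈ Finset.range v, a i

theorem prefixSum_succ (a : ℕ → ℕ) (v : ℕ) : prefixSum a (v + 1) = prefixSum a v + a v :=
  Finset.sum_range_succ _ _

theorem prefixSum_update_of_le (a : ℕ → ℕ) {n v : ℕ} (t : ℕ) (h : v ≤ n) :
    prefixSum (Function.update a n t) v = prefixSum a v :=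
  Finset.sum_congr rfl fun i hi => by
    rw [Function.update_of_ne]
    have := Finset.mem_range.1 hi
    omega

theorem prefixSum_update_succ (a : ℕ → ℕ) (n t : ℕ) :
    prefixSum (Function.update a n t) (n + 1) = prefixSum a n + t := by
  rw [prefixSum_succ, prefixSum_update_of_le _ _ le_rfl, Function.update_self]

theorem prefixSum_mono (a : ℕ → ℕ) : Monotone (prefixSum a) :=
  monotone_nat_of_le_succ fun v => by
    rw [prefixSum_succ]
    omega

theorem prefixSum_le {a : ℕ → ℕ} {n : ℕ} (ha : ∀ i, n ≤ i → a i = 0) (v : ℕ) :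
    prefixSum a v ≤ prefixSum a n := by
  rcases le_total v n with h | h
  · exact prefixSum_mono a h
  · induction v, h using Nat.le_induction with
    | base => exact le_rfl
    | succ v hv ih => rwa [prefixSum_succ, ha v hv, add_zero]

/-- The ballot condition: with `b = m - a`, the first `v + 1` entries of `b` sum to at most
the sum of the first `v` entries of `a`, for all `v < n`. -/
def IsBallot (m : ℕ → ℕ) (n : ℕ) (a : ℕ → ℕ) : Prop :=
  ∀ v < n, prefixSum m (v + 1) ≤ prefixSum a v + prefixSum a (v + 1)

theorem isBallot_update (m : ℕ → ℕ) (n : ℕ) (a : ℕ → ℕ) (t : ℕ) :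
    IsBallot m (n + 1) (Function.update a n t) ↔
      IsBallot m n a ∧ prefixSum m (n + 1) ≤ prefixSum a n + (prefixSum a n + t) := by
  constructor
  · intro h
    refine ⟨fun v hv => ?_, ?_⟩
    · have := h v (by omega)
      rwa [prefixSum_update_of_le _ _ hv.le, prefixSum_update_of_le _ _ hv] at this
    · have := h n (by omega)
      rwa [prefixSum_update_of_le _ _ le_rfl, prefixSum_update_succ] at this
  · rintro ⟨h1, h2⟩ v hv
    rcases Nat.lt_succ_iff_lt_or_eq.1 hv with h | rfl
    · rw [prefixSum_update_of_le _ _ h.le, prefixSum_update_of_le _ _ h]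
      exact h1 v h
    · rwa [prefixSum_update_of_le _ _ le_rfl, prefixSum_update_succ]

open Classical in
/-- The number of vectors of sum `j` in `boundedVectors m n`. -/
def vectorCount (m : ℕ → ℕ) (n : ℕ) (j : ℤ) : ℤ :=
  ∑ a ∈ boundedVectors m n, if (prefixSum a n : ℤ) = j then 1 else 0

open Classical in
/-- The number of vectors of sum `j` in `boundedVectors m n` that satisfy the ballot condition. -/
def ballotCount (m : ℕ → ℕ) (n : ℕ) (j : ℤ) : ℤ :=
  ∑ a ∈ boundedVectors m n, if (prefixSum a n : ℤ) = j ∧ IsBallot m n a then 1 else 0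

theorem vectorCount_succ (m : ℕ → ℕ) (n : ℕ) (j : ℤ) :
    vectorCount m (n + 1) j = ∑ t ∈ Finset.range (m n + 1), vectorCount m n (j - t) := by
  simp only [vectorCount, sum_boundedVectors_succ, prefixSum_update_succ]
  refine Finset.sum_congr rfl fun t _ => Finset.sum_congr rfl fun a _ => ?_
  congr 1
  simp only [eq_iff_iff]
  push_cast
  omega

/-- Once the total j and the last entry t are fixed, the last ballot inequality compares the total
of m with (j - t) + j, so it involves no other entry. -/
theorem ballotCount_succ (m : ℕ → ℕ) (n : ℕ) (j : ℤ) :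
    ballotCount m (n + 1) j = ∑ t ∈ Finset.range (m n + 1),
      if (prefixSum m (n + 1) : ℤ) + t ≤ 2 * j then ballotCount m n (j - t) else 0 := by
  classical
  rw [ballotCount, sum_boundedVectors_succ]
  refine Finset.sum_congr rfl fun t _ => ?_
  split_ifs with h
  · refine Finset.sum_congr rfl fun a _ => if_congr ?_ rfl rfl
    rw [isBallot_update, prefixSum_update_succ]
    push_cast
    constructor
    · rintro ⟨h1, h2, h3⟩
      exact ⟨by omega, h2⟩
    · rintro ⟨h1, h2⟩
      exact ⟨by omega, h2, by omega⟩
  · refine Finset.sum_eq_zero fun a _ => if_neg ?_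
    rw [isBallot_update, prefixSum_update_succ]
    rintro ⟨h1, h2, h3⟩
    push_cast at h1
    omega

/-- This is the symmetry a ↦ m - a. -/
theorem vectorCount_symm (m : ℕ → ℕ) (n : ℕ) (j : ℤ) :
    vectorCount m n (prefixSum m n - j) = vectorCount m n j := by
  induction n generalizing j with
  | zero => simp [vectorCount, boundedVectors, prefixSum, eq_comm]
  | succ n ih =>
    rw [vectorCount_succ, vectorCount_succ, ← Finset.sum_range_reflect]
    refine Finset.sum_congr rfl fun t ht => ?_
    have := Finset.mem_range.1 ht
    rw [← ih, prefixSum_succ]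
    congr 1
    push_cast
    omega

theorem sum_range_ite_sub (G : ℕ → ℤ) (m : ℕ) (K : ℕ) :
    (∑ t ∈ Finset.range (m + 1), if t ≤ K then G (t + 1) - G t else 0) =
      G (min m K + 1) - G 0 := by
  induction m with
  | zero => simp
  | succ m ih =>
    rw [Finset.sum_range_succ, ih]
    split_ifs with h
    · rw [min_eq_left h, min_eq_left (by omega)]
      ring
    · rw [min_eq_right (by omega), min_eq_right (by omega), add_zero]

/-- Both sides are sums over the last entry t of the differences V(j - t) - V(j + 1 - t), where V
counts vectors of length n; the ballot side stops at t = K. Both telescope, and the two upper ends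
agree by the symmetry of V. -/
theorem ballotCount_eq (m : ℕ → ℕ) (n : ℕ) (j : ℤ) :
    ballotCount m n j =
      if (prefixSum m n : ℤ) ≤ 2 * j then vectorCount m n j - vectorCount m n (j + 1) else 0 := by
  induction n generalizing j with
  | zero =>
    simp only [ballotCount, vectorCount, boundedVectors, IsBallot, prefixSum]
    simp
    split_ifs <;> omega
  | succ n ih =>
    rw [ballotCount_succ]
    have hM := prefixSum_succ m n
    split_ifs with h
    · obtain ⟨K, hK⟩ : ∃ K : ℕ, 2 * j = (prefixSum m (n + 1) : ℤ) + K :=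
        ⟨(2 * j - prefixSum m (n + 1)).toNat, by omega⟩
      set G : ℕ → ℤ := fun t => vectorCount m n (j + 1 - t) with hG
      have h1 : ∀ t ∈ Finset.range (m n + 1), (if (prefixSum m (n + 1) : ℤ) + t ≤ 2 * j then
          ballotCount m n (j - t) else 0) = if t ≤ K then G (t + 1) - G t else 0 := by
        intro t ht
        have ht' := Finset.mem_range.1 ht
        by_cases hc : t ≤ K
        · rw [if_pos hc, if_pos (by omega), ih, if_pos (by omega), hG]
          simp only
          congr 2 <;> push_cast <;> ring
        · rw [if_neg hc, if_neg (by omega)]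
      rw [Finset.sum_congr rfl h1, sum_range_ite_sub, vectorCount_succ, vectorCount_succ,
        ← Finset.sum_sub_distrib]
      have h2 : ∀ t ∈ Finset.range (m n + 1), vectorCount m n (j - t) -
          vectorCount m n (j + 1 - t) = G (t + 1) - G t := by
        intro t _
        rw [hG]
        simp only
        congr 2
        push_cast
        ring
      rw [Finset.sum_congr rfl h2, Finset.sum_range_sub]
      congr 1
      -- If K < m n, the ends are V(j - K) and V(j - m n); their arguments add up to the sum of the
      -- first n entries of m because K = 2j - (sum of the first n + 1 entries).
      rcases le_total (m n) K with hc | hc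
      · rw [min_eq_left hc]
      · rw [min_eq_right hc, hG]
        simp only
        rw [← vectorCount_symm]
        congr 1
        push_cast
        omega
    · exact Finset.sum_eq_zero fun t _ => if_neg (by omega)

/-! ### Tableaux with two equal rows -/

theorem mem_twoRows {d i j : ℕ} : (i, j) ∈ twoRows d ↔ i < 2 ∧ j < d := by
  rw [← YoungDiagram.mem_cells]
  simp [twoRows]

/-- The number of entries `i` among the first `d` values of `f`. -/
def valueCount (d : ℕ) (f : ℕ → ℕ) (i : ℕ) : ℕ := ((Finset.range d).filter fun j => f j = i).card

theorem prefixSum_valueCount (d : ℕ) (f : ℕ → ℕ) (v : ℕ) :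
    prefixSum (valueCount d f) v = ((Finset.range d).filter fun j => f j < v).card := by
  induction v with
  | zero => simp [prefixSum]
  | succ v ih =>
    rw [prefixSum_succ, ih, valueCount, ← Finset.card_union_of_disjoint]
    · congr 1
      ext j
      simp only [Finset.mem_union, Finset.mem_filter, Finset.mem_range]
      omega
    · rw [Finset.disjoint_filter]
      intro j _ h
      omega

/-- In a weakly increasing row the entries below v fill an initial segment, so the value counts
determine the row. -/
theorem lt_iff_lt_prefixSum {d : ℕ} {f : ℕ → ℕ} (hf : ∀ i j, i ≤ j → j < d → f i ≤ f j) {j : ℕ}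
    (hj : j < d) (v : ℕ) : f j < v ↔ j < prefixSum (valueCount d f) v := by
  rw [prefixSum_valueCount]
  constructor
  · intro h
    have hsub : Finset.range (j + 1) ⊆ (Finset.range d).filter fun j => f j < v := by
      intro i hi
      have hi' := Finset.mem_range.1 hi
      have := hf i j (by omega) hj
      simp only [Finset.mem_filter, Finset.mem_range]
      omega
    have := Finset.card_le_card hsub
    rw [Finset.card_range] at this
    omega
  · intro h
    by_contra hv
    have hsub : ((Finset.range d).filter fun j => f j < v) ⊆ Finset.range j := by
      intro i hi
      simp only [Finset.mem_filter, Finset.mem_range] at hi ⊢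
      by_contra hij
      have := hf j i (by omega) hi.1
      omega
    have := Finset.card_le_card hsub
    rw [Finset.card_range] at this
    omega

/-- The row with prescribed value counts: entry j is the least v for which more than j entries are
to be at most v. It is 0 beyond d, as tableaux require outside their shape. -/
theorem exists_row {a : ℕ → ℕ} {n d : ℕ} (ha : prefixSum a n = d) :
    ∃ r : ℕ → ℕ, (∀ j < d, ∀ v, r j < v ↔ j < prefixSum a v) ∧ ∀ j, d ≤ j → r j = 0 := by
  classical
  have hex : ∀ j, j < d → ∃ v, j < prefixSum a (v + 1) := fun j hj =>
    ⟨n, by have := prefixSum_succ a n; omega⟩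
  refine ⟨fun j => if h : j < d then Nat.find (hex j h) else 0, fun j hj v => ?_, fun j hj => ?_⟩
  · simp only [hj, dif_pos]
    rw [Nat.find_lt_iff]
    constructor
    · rintro ⟨u, hu, h⟩
      exact h.trans_le (prefixSum_mono a hu)
    · intro h
      cases v with
      | zero => simp [prefixSum] at h
      | succ v => exact ⟨v, by omega, h⟩
  · simp [hj]

theorem row_mono {a r : ℕ → ℕ} {d : ℕ} (hr : ∀ j < d, ∀ v, r j < v ↔ j < prefixSum a v)
    {i j : ℕ} (hij : i ≤ j) (hj : j < d) : r i ≤ r j := by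
  have h1 := (hr j hj (r j + 1)).1 (by omega)
  have h2 := (hr i (by omega) (r j + 1)).2 (by omega)
  omega

theorem valueCount_row {a r : ℕ → ℕ} {d : ℕ} (hr : ∀ j < d, ∀ v, r j < v ↔ j < prefixSum a v)
    (ha : ∀ v, prefixSum a v ≤ d) : valueCount d r = a := by
  have h : ∀ v, prefixSum (valueCount d r) v = prefixSum a v := by
    intro v
    have hset : ((Finset.range d).filter fun j => r j < v) = Finset.range (prefixSum a v) := by
      ext j
      have := ha v
      simp only [Finset.mem_filter, Finset.mem_range]
      constructor
      · rintro ⟨h1, h2⟩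
        exact (hr j h1 v).1 h2
      · intro h
        exact ⟨by omega, (hr j (by omega) v).2 h⟩
    rw [prefixSum_valueCount, hset, Finset.card_range]
  funext v
  have h1 := h v
  have h2 := h (v + 1)
  rw [prefixSum_succ, prefixSum_succ] at h2
  omega

/-- The content of a tableau. -/
def content {lam : YoungDiagram} (T : SemistandardYoungTableau lam) : ℕ →₀ ℕ :=
  ∑ c ∈ lam.cells, Finsupp.single (T c.1 c.2) 1

theorem tableauMonomial_eq {lam : YoungDiagram} (T : SemistandardYoungTableau lam) :
    tableauMonomial T = MvPolynomial.monomial (content T) 1 := by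
  rw [content, MvPolynomial.monomial_sum_one]
  rfl

theorem content_twoRows {d : ℕ} (T : SemistandardYoungTableau (twoRows d)) (i : ℕ) :
    content T i = valueCount d (T 0) i + valueCount d (T 1) i := by
  rw [content, Finsupp.finsetSum_apply]
  change ∑ c ∈ Finset.range 2 ×ˢ Finset.range d, _ = _
  rw [Finset.sum_product, Finset.sum_range_succ, Finset.sum_range_one, valueCount, valueCount,
    Finset.card_filter, Finset.card_filter]
  simp [Finsupp.single_apply]

theorem degree_content {lam : YoungDiagram} (T : SemistandardYoungTableau lam) :
    (content T).degree = lam.card := by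
  rw [content, map_sum]
  simp [YoungDiagram.card]

theorem card_twoRows (d : ℕ) : (twoRows d).card = 2 * d := by
  simp [YoungDiagram.card, twoRows]

theorem twoRows_row_mono {d : ℕ} (T : SemistandardYoungTableau (twoRows d)) {p : ℕ} (hp : p < 2)
    (i j : ℕ) (hij : i ≤ j) (hj : j < d) : T p i ≤ T p j :=
  T.row_weak_of_le hij (mem_twoRows.2 ⟨hp, hj⟩)

theorem twoRows_ext {d : ℕ} {T T' : SemistandardYoungTableau (twoRows d)}
    (h : ∀ p < 2, valueCount d (T p) = valueCount d (T' p)) : T = T' := by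
  refine SemistandardYoungTableau.ext fun p j => ?_
  by_cases hc : (p, j) ∈ twoRows d
  · obtain ⟨hp, hj⟩ := mem_twoRows.1 hc
    refine eq_of_forall_gt_iff fun v => ?_
    rw [lt_iff_lt_prefixSum (twoRows_row_mono T hp) hj,
      lt_iff_lt_prefixSum (twoRows_row_mono T' hp) hj, h p hp]
  · rw [T.zeros hc, T'.zeros hc]

theorem prefixSum_add_valueCount {d : ℕ} {T : SemistandardYoungTableau (twoRows d)} {m : ℕ →₀ ℕ}
    (hT : content T = m) (v : ℕ) :
    prefixSum m v = prefixSum (valueCount d (T 0)) v + prefixSum (valueCount d (T 1)) v := by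
  rw [prefixSum, prefixSum, prefixSum, ← Finset.sum_add_distrib]
  exact Finset.sum_congr rfl fun i _ => by rw [← hT, content_twoRows]

/-- The first row has count vector a and the second is forced to have m - a. Strictness of the
columns is the ballot condition. -/
theorem bijOn_valueCount {d n : ℕ} {m : ℕ →₀ ℕ} (hm : ∀ i, n ≤ i → m i = 0)
    (hdeg : prefixSum m n = 2 * d) :
    Set.BijOn (fun T : SemistandardYoungTableau (twoRows d) => valueCount d (T 0))
      {T | content T = m}
      {a | a ∈ boundedVectors m n ∧ prefixSum a n = d ∧ IsBallot m n a} := by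
  have hle : ∀ T : SemistandardYoungTableau (twoRows d), content T = m →
      ∀ i, valueCount d (T 0) i + valueCount d (T 1) i = m i := by
    intro T hT i
    rw [← content_twoRows, hT]
  refine ⟨fun T hT => ?_, fun T hT T' hT' h => ?_, fun a ha => ?_⟩
  · have hT' := hle T hT
    have hlt : ∀ j < d, T 0 j < n := by
      intro j hj
      by_contra hn
      have h1 := hT' (T 0 j)
      rw [hm _ (by omega)] at h1
      have h2 : valueCount d (T 0) (T 0 j) = 0 := by omega
      rw [valueCount, Finset.card_eq_zero, Finset.filter_eq_empty_iff] at h2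
      exact h2 (Finset.mem_range.2 hj) rfl
    refine ⟨mem_boundedVectors.2 ⟨fun i => ?_, fun i hi => ?_⟩, ?_, fun v _ => ?_⟩
    · exact (Nat.le_add_right _ _).trans_eq (hT' i)
    · exact (Nat.add_eq_zero_iff.1 ((hT' i).trans (hm i hi))).1
    · rw [prefixSum_valueCount, Finset.filter_true_of_mem, Finset.card_range]
      exact fun j hj => hlt j (Finset.mem_range.1 hj)
    -- A column whose bottom entry is at most v has its top entry below v.
    · rw [prefixSum_add_valueCount hT, add_comm]
      refine Nat.add_le_add_right ?_ _
      rw [prefixSum_valueCount, prefixSum_valueCount]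
      refine Finset.card_le_card fun j hj => ?_
      simp only [Finset.mem_filter, Finset.mem_range] at hj ⊢
      have := T.col_strict (i1 := 0) (i2 := 1) (by omega) (mem_twoRows.2 ⟨by omega, hj.1⟩)
      omega
  · refine twoRows_ext fun p hp => ?_
    have h0 : valueCount d (T 0) = valueCount d (T' 0) := h
    have h1 : valueCount d (T 1) = valueCount d (T' 1) := by
      funext i
      have h2 := hle T hT i
      have h3 := hle T' hT' i
      rw [h0] at h2
      omega
    interval_cases p
    · exact h0
    · exact h1
  · obtain ⟨ha, hd, hb⟩ := ha
    obtain ⟨ham, ha0⟩ := mem_boundedVectors.1 ha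
    set b : ℕ → ℕ := fun i => m i - a i with hbdef
    have hab : ∀ v, prefixSum a v + prefixSum b v = prefixSum m v := by
      intro v
      rw [prefixSum, prefixSum, prefixSum, ← Finset.sum_add_distrib]
      exact Finset.sum_congr rfl fun i _ => Nat.add_sub_cancel' (ham i)
    have hbd : prefixSum b n = d := by
      have := hab n
      omega
    obtain ⟨r, hr, hr0⟩ := exists_row hd
    obtain ⟨s, hs, hs0⟩ := exists_row hbd
    have hra := valueCount_row hr fun v => (prefixSum_le ha0 v).trans_eq hd
    have hsb := valueCount_row hs fun v => (prefixSum_le (fun i hi => by simp [hbdef, hm i hi])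
      v).trans_eq hbd
    -- With v = s j, position j lies among the second-row entries at most v. By the ballot condition
    -- it lies among the first-row entries below v.
    have hrs : ∀ j < d, r j < s j := by
      intro j hj
      have h1 := (hs j hj (s j + 1)).1 (by omega)
      have h2 := (hs j hj n).2 (by omega)
      have h3 := hb _ h2
      have h4 := hab (s j + 1)
      exact (hr j hj (s j)).2 (by omega)
    let T : SemistandardYoungTableau (twoRows d) :=
      { entry := fun i j => if i = 0 then r j else if i = 1 then s j else 0
        row_weak' := by
          intro i j1 j2 hj hc
          obtain ⟨hi, hj2⟩ := mem_twoRows.1 hc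
          interval_cases i
          · exact row_mono hr hj.le hj2
          · exact row_mono hs hj.le hj2
        col_strict' := by
          intro i1 i2 j hi hc
          obtain ⟨hi2, hj⟩ := mem_twoRows.1 hc
          obtain rfl : i1 = 0 := by omega
          obtain rfl : i2 = 1 := by omega
          exact hrs j hj
        zeros' := by
          intro i j hc
          rw [mem_twoRows] at hc
          by_cases h0 : i = 0
          · simpa [h0] using hr0 j (by omega)
          · by_cases h1 : i = 1
            · simpa [h1] using hs0 j (by omega)
            · simp [h0, h1] }
    have hT0 : valueCount d (T 0) = a := hra
    have hT1 : valueCount d (T 1) = b := hsb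
    refine ⟨T, Finsupp.ext fun i => ?_, hT0⟩
    rw [content_twoRows, hT0, hT1]
    exact Nat.add_sub_cancel' (ham i)

/-! ### Coefficients of products of complete functions; Jacobi–Trudi. -/

/-- The complete homogeneous symmetric function `h_j`; it is `0` for negative `j`. -/
def completeSeries (j : ℤ) : ZSeries := fun m => if (m.degree : ℤ) = j then 1 else 0

theorem coeff_completeSeries (j : ℤ) (m : ℕ →₀ ℕ) :
    MvPowerSeries.coeff m (completeSeries j) = if (m.degree : ℤ) = j then 1 else 0 := rfl

theorem prefixSum_eq_degree {m : ℕ →₀ ℕ} {n : ℕ} (hm : ∀ i, n ≤ i → m i = 0) :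
    prefixSum m n = m.degree := by
  rw [Finsupp.degree_apply, prefixSum]
  refine (Finset.sum_subset (fun i hi => ?_) fun i _ hi => Finsupp.notMem_support_iff.1 hi).symm
  by_contra h
  exact Finsupp.mem_support_iff.1 hi (hm i (by simpa using h))

theorem exists_support_bound (m : ℕ →₀ ℕ) : ∃ n, ∀ i, n ≤ i → m i = 0 := by
  refine ⟨m.support.sup id + 1, fun i hi => ?_⟩
  by_contra h
  have := Finset.le_sup (f := id) (Finsupp.mem_support_iff.2 h)
  simp only [id] at this
  omega

/-- Factoring z^m into monomials of degrees i and j amounts to choosing an exponent vector a ≤ m of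
sum i. -/
theorem coeff_completeSeries_mul {m : ℕ →₀ ℕ} {n : ℕ} (hm : ∀ i, n ≤ i → m i = 0) (i j : ℤ) :
    MvPowerSeries.coeff m (completeSeries i * completeSeries j) =
      if (m.degree : ℤ) = i + j then (vectorCount m n i : ℂ) else 0 := by
  classical
  rw [MvPowerSeries.coeff_mul]
  simp only [coeff_completeSeries]
  have hdeg : ∀ p ∈ Finset.HasAntidiagonal.antidiagonal m, p.1.degree + p.2.degree = m.degree := by
    intro p hp
    rw [← Finset.HasAntidiagonal.mem_antidiagonal.1 hp, map_add]
  split_ifs with h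
  · rw [vectorCount, Int.cast_sum]
    refine Finset.sum_nbij (fun p => ⇑p.1) ?_ ?_ ?_ ?_
    · intro p hp
      have hp' : ∀ i, p.1 i + p.2 i = m i := fun i => by
        rw [← Finset.HasAntidiagonal.mem_antidiagonal.1 hp, Finsupp.add_apply]
      refine mem_boundedVectors.2 ⟨fun i => ?_, fun i hi => ?_⟩
      · have := hp' i
        omega
      · have := hp' i
        rw [hm i hi] at this
        omega
    · intro p hp p' hp' h
      have h1 : p.1 = p'.1 := DFunLike.coe_injective h
      have h2 := (Finset.HasAntidiagonal.mem_antidiagonal.1 hp).trans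
        (Finset.HasAntidiagonal.mem_antidiagonal.1 hp').symm
      rw [h1] at h2
      exact Prod.ext h1 (add_left_cancel h2)
    · intro a ha
      obtain ⟨h1, h2⟩ := mem_boundedVectors.1 ha
      let a' : ℕ →₀ ℕ := Finsupp.onFinset m.support a fun i hi => by
        have := h1 i
        exact Finsupp.mem_support_iff.2 (by omega)
      refine ⟨(a', m - a'),
        Finset.HasAntidiagonal.mem_antidiagonal.2 (add_tsub_cancel_of_le h1), rfl⟩
    · intro p hp
      have hpd := hdeg p hp
      have hp0 : ∀ i, n ≤ i → p.1 i = 0 := fun i hi => by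
        have : p.1 i + p.2 i = m i := by
          rw [← Finset.HasAntidiagonal.mem_antidiagonal.1 hp, Finsupp.add_apply]
        rw [hm i hi] at this
        omega
      rw [prefixSum_eq_degree hp0]
      by_cases h1 : (p.1.degree : ℤ) = i
      · rw [if_pos h1, if_pos h1, if_pos (by omega)]
        simp
      · rw [if_neg h1, if_neg h1]
        simp
  · refine Finset.sum_eq_zero fun p hp => ?_
    have hpd := hdeg p hp
    by_cases h1 : (p.1.degree : ℤ) = i
    · rw [if_neg (c := (p.2.degree : ℤ) = j) (by omega), mul_zero]
    · rw [if_neg h1, zero_mul]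

theorem schurFunction_coeff {lam : YoungDiagram} (m : ℕ →₀ ℕ) :
    MvPowerSeries.coeff m (schurFunction lam) =
      ∑ᶠ (T : SemistandardYoungTableau lam) (_ : T ∈ {T | content T = m}), 1 := by
  change ∑ᶠ T : SemistandardYoungTableau lam, (tableauMonomial T).coeff m = _
  refine finsum_congr fun T => ?_
  rw [tableauMonomial_eq, MvPolynomial.coeff_monomial, finsum_eq_if]
  rfl

/-- The Jacobi–Trudi formula for the partition `(d, d)`. -/
theorem schurFunction_twoRows (d : ℕ) :
    schurFunction (twoRows d) = completeSeries d * completeSeries d -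
      completeSeries (d + 1) * completeSeries (d - 1) := by
  classical
  refine MvPowerSeries.ext fun m => ?_
  obtain ⟨n, hm⟩ := exists_support_bound m
  rw [map_sub, coeff_completeSeries_mul hm, coeff_completeSeries_mul hm, schurFunction_coeff]
  by_cases hdeg : m.degree = 2 * d
  · have hpre := (prefixSum_eq_degree hm).trans hdeg
    rw [if_pos (by omega), if_pos (by omega), ← Int.cast_sub,
      finsum_mem_eq_of_bijOn (g := fun _ => (1 : ℂ)) _ (bijOn_valueCount hm hpre) fun _ _ => rfl]
    -- Since m has sum 2d, the inequality in `ballotCount_eq` holds with equality at j = d.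
    have h := ballotCount_eq m n d
    rw [if_pos (by omega)] at h
    rw [← h, ballotCount, ← Finset.sum_filter, Int.cast_sum,
      ← finsum_mem_coe_finset]
    simp
  · rw [if_neg (by omega), if_neg (by omega), sub_zero]
    refine finsum_mem_eq_zero_of_forall_eq_zero fun T hT => ?_
    exact absurd (by rw [← (show content T = m from hT), degree_content, card_twoRows]) hdeg

/-! ### Power sums and complete homogeneous functions -/

theorem coeff_powerSum (k : ℕ) (m : ℕ →₀ ℕ) [Decidable (∃ i : ℕ, m = Finsupp.single i k)] :
    MvPowerSeries.coeff m (powerSum k) = if ∃ i : ℕ, m = Finsupp.single i k then 1 else 0 := by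
  have h : MvPowerSeries.coeff m (powerSum k) = powerSum k m := rfl
  rw [h, powerSum]
  congr

theorem coeff_powerSum_mul_completeSeries {k : ℕ} (hk : 0 < k) (j : ℤ) (m : ℕ →₀ ℕ) :
    MvPowerSeries.coeff m (powerSum k * completeSeries j) =
      if (m.degree : ℤ) = k + j then ∑ i ∈ m.support, if k ≤ m i then 1 else 0 else 0 := by
  classical
  rw [MvPowerSeries.coeff_mul]
  simp only [coeff_completeSeries, coeff_powerSum]
  have hdeg : ∀ p ∈ Finset.HasAntidiagonal.antidiagonal m, p.1.degree + p.2.degree = m.degree := by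
    intro p hp
    rw [← Finset.HasAntidiagonal.mem_antidiagonal.1 hp, map_add]
  split_ifs with h
  · rw [← Finset.sum_filter]
    symm
    refine Finset.sum_of_injOn (fun i => (Finsupp.single i k, m - Finsupp.single i k))
      ?_ ?_ ?_ ?_
    · intro i _ i' _ hii
      exact (Finsupp.single_left_inj hk.ne').1 (Prod.ext_iff.1 hii).1
    · intro i hi
      have hi' := (Finset.mem_filter.1 hi).2
      exact Finset.HasAntidiagonal.mem_antidiagonal.2
        (add_tsub_cancel_of_le (Finsupp.single_le_iff.2 hi'))
    · intro p hp hne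
      rw [if_neg, zero_mul]
      rintro ⟨i, hi⟩
      refine hne ⟨i, ?_, ?_⟩
      · have hle : k ≤ m i := by
          rw [← Finset.HasAntidiagonal.mem_antidiagonal.1 hp, hi]
          simp
        exact Finset.mem_coe.2 (Finset.mem_filter.2 ⟨Finsupp.mem_support_iff.2 (by omega), hle⟩)
      · refine Prod.ext hi.symm ?_
        change m - Finsupp.single i k = p.2
        rw [← Finset.HasAntidiagonal.mem_antidiagonal.1 hp, hi, add_tsub_cancel_left]
    · intro i hi
      have hi' := (Finset.mem_filter.1 hi).2
      have h1 := hdeg (Finsupp.single i k, m - Finsupp.single i k)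
        (Finset.HasAntidiagonal.mem_antidiagonal.2
          (add_tsub_cancel_of_le (Finsupp.single_le_iff.2 hi')))
      simp only [Finsupp.degree_single] at h1
      rw [if_pos ⟨i, rfl⟩, if_pos (by simp only; omega), one_mul]
  · refine Finset.sum_eq_zero fun p hp => ?_
    have hpd := hdeg p hp
    by_cases h1 : ∃ i, p.1 = Finsupp.single i k
    · obtain ⟨i, hi⟩ := h1
      rw [hi, Finsupp.degree_single] at hpd
      rw [if_neg (c := (p.2.degree : ℤ) = j) (by omega), mul_zero]
    · rw [if_neg h1, zero_mul]

/-- Newton's identity. -/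
theorem smul_completeSeries (d : ℕ) :
    (d : ℂ) • completeSeries d = ∑ k ∈ Finset.Icc 1 d, powerSum k * completeSeries (d - k) := by
  refine MvPowerSeries.ext fun m => ?_
  rw [map_smul, map_sum, coeff_completeSeries, smul_eq_mul]
  rw [Finset.sum_congr rfl fun k hk =>
    coeff_powerSum_mul_completeSeries (Finset.mem_Icc.1 hk).1 _ m]
  simp only [add_sub_cancel, Nat.cast_inj]
  split_ifs with h
  -- The variable i is counted once for each k from 1 to m i, so the total is the degree of m.
  · rw [Finset.sum_comm, mul_one, ← h, Finsupp.degree_apply, Nat.cast_sum]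
    refine Finset.sum_congr rfl fun i hi => ?_
    rw [← Finset.sum_filter]
    have hle : m i ≤ m.degree := Finsupp.le_degree i m
    have hset : (Finset.Icc 1 (∑ i ∈ m.support, m i)).filter (fun k => k ≤ m i) =
        Finset.Icc 1 (m i) := by
      ext k
      rw [Finsupp.degree_apply] at hle
      simp only [Finset.mem_filter, Finset.mem_Icc]
      omega
    rw [hset]
    simp
  · simp

theorem completeSeries_of_neg {j : ℤ} (hj : j < 0) : completeSeries j = 0 := by
  refine MvPowerSeries.ext fun m => ?_
  rw [coeff_completeSeries, if_neg (by omega), map_zero]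

theorem completeSeries_zero : completeSeries 0 = 1 := by
  classical
  refine MvPowerSeries.ext fun m => ?_
  rw [coeff_completeSeries, MvPowerSeries.coeff_one]
  simp [Finsupp.degree_eq_zero_iff]

/-- Newton's identity expresses d h_d by power sums and earlier h's, and d is invertible in ℂ. -/
theorem completeSeries_mem_range (j : ℤ) : completeSeries j ∈
    (MvPolynomial.aeval (R := ℂ) fun k : ℕ+ => powerSum (k : ℕ)).range := by
  rcases lt_or_ge j 0 with hj | hj
  · rw [completeSeries_of_neg hj]
    exact Subalgebra.zero_mem _
  · lift j to ℕ using hj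
    induction j using Nat.strong_induction_on with
    | _ d ih =>
      rcases Nat.eq_zero_or_pos d with rfl | hd
      · rw [Nat.cast_zero, completeSeries_zero]
        exact Subalgebra.one_mem _
      · have hd' : (d : ℂ) ≠ 0 := by exact_mod_cast hd.ne'
        rw [← inv_smul_smul₀ hd' (completeSeries d), smul_completeSeries]
        refine Subalgebra.smul_mem _ (Subalgebra.sum_mem _ fun k hk => ?_) _
        obtain ⟨h1, h2⟩ := Finset.mem_Icc.1 hk
        refine Subalgebra.mul_mem _ ⟨MvPolynomial.X ⟨k, h1⟩, ?_⟩ ?_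
        · exact MvPolynomial.aeval_X _ _
        · have := ih (d - k) (by omega)
          rwa [Nat.cast_sub h2] at this

theorem exists_isPowerSumExpansion (d : ℕ) :
    ∃ P : MvPolynomial ℕ+ ℂ, IsPowerSumExpansion P (schurFunction (twoRows d)) := by
  have h : schurFunction (twoRows d) ∈
      (MvPolynomial.aeval (R := ℂ) fun k : ℕ+ => powerSum (k : ℕ)).range := by
    rw [schurFunction_twoRows]
    exact Subalgebra.sub_mem _
      (Subalgebra.mul_mem _ (completeSeries_mem_range _) (completeSeries_mem_range _))
      (Subalgebra.mul_mem _ (completeSeries_mem_range _) (completeSeries_mem_range _))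
  exact h

/-! ### Specialization at finitely many values -/

/-- The values `q_1, …, q_n` followed by zeros. -/
def extendZero {n : ℕ} (q : Fin n → ℂ) (i : ℕ) : ℂ := if h : i < n then q ⟨i, h⟩ else 0

/-- The value of the monomial `z^m` at `q_1, …, q_n, 0, 0, …`. -/
def monomialValue {n : ℕ} (q : Fin n → ℂ) (m : ℕ →₀ ℕ) : ℂ := m.prod fun i e => extendZero q i ^ e

theorem monomialValue_eq_zero {n : ℕ} {q : Fin n → ℂ} {m : ℕ →₀ ℕ} {i : ℕ} (hi : n ≤ i)
    (hm : m i ≠ 0) : monomialValue q m = 0 :=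
  Finset.prod_eq_zero (Finsupp.mem_support_iff.2 hm) (by
    simp [extendZero, Nat.not_lt.2 hi, hm])

/-- Numbers cannot be substituted into a formal series; the factor T removes the constant terms, and
only finitely many images are nonzero. -/
theorem hasSubst_extendZero {n : ℕ} (q : Fin n → ℂ) :
    MvPowerSeries.HasSubst (fun i : ℕ =>
      (PowerSeries.C (extendZero q i) * PowerSeries.X : PowerSeries ℂ)) where
  const_coeff i := by
    have h : MvPowerSeries.constantCoeff
        (PowerSeries.C (extendZero q i) * PowerSeries.X : PowerSeries ℂ) = 0 := by
      change PowerSeries.constantCoeff _ = 0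
      simp
    rw [h]
    exact IsNilpotent.zero
  coeff_zero d := by
    refine (Set.finite_lt_nat n).subset fun i hi => ?_
    by_contra h
    refine hi ?_
    simp [extendZero, show ¬ i < n from h]

/-- The substitution `z_i ↦ q_i T` for `i < n` and `z_i ↦ 0` for `i ≥ n`. -/
def specialize {n : ℕ} (q : Fin n → ℂ) : ZSeries →ₐ[ℂ] PowerSeries ℂ :=
  MvPowerSeries.substAlgHom (hasSubst_extendZero q)

theorem coeff_specialize {n : ℕ} (q : Fin n → ℂ) (f : ZSeries) (k : ℕ) :
    PowerSeries.coeff k (specialize q f) =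
      ∑ᶠ m : ℕ →₀ ℕ, if m.degree = k then MvPowerSeries.coeff m f * monomialValue q m else 0 := by
  rw [specialize, MvPowerSeries.substAlgHom_apply, PowerSeries.coeff, MvPowerSeries.coeff_subst
    (hasSubst_extendZero q)]
  refine finsum_congr fun m => ?_
  have h : (m.prod fun i e => (PowerSeries.C (extendZero q i) * PowerSeries.X : PowerSeries ℂ) ^ e)
      = PowerSeries.C (monomialValue q m) * PowerSeries.X ^ m.degree := by
    simp only [mul_pow, Finsupp.prod, Finset.prod_mul_distrib, monomialValue, map_prod, map_pow,
      Finset.prod_pow_eq_pow_sum, Finsupp.degree_apply]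
  rw [h, ← PowerSeries.coeff, PowerSeries.coeff_C_mul, PowerSeries.coeff_X_pow, smul_eq_mul]
  simp only [eq_comm (a := k)]
  split_ifs <;> simp

theorem monomialValue_mapDomain {n : ℕ} (q : Fin n → ℂ) (a : Fin n →₀ ℕ) :
    monomialValue q (a.mapDomain Fin.val) = ∏ i, q i ^ a i := by
  rw [monomialValue, Finsupp.prod_mapDomain_index_inj Fin.val_injective,
    Finsupp.prod_fintype _ _ fun _ => pow_zero _]
  simp [extendZero]

theorem specialize_completeSeries {n : ℕ} (q : Fin n → ℂ) (j : ℤ) :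
    specialize q (completeSeries j) =
      PowerSeries.C (completeValue q j) * PowerSeries.X ^ j.toNat := by
  have hval : ∑ᶠ m : ℕ →₀ ℕ, (if (m.degree : ℤ) = j then monomialValue q m else 0) =
      completeValue q j := by
    classical
    rw [completeValue, finsum_mem_eq_of_bijOn (t := {m : ℕ →₀ ℕ | (m.degree : ℤ) = j ∧
        ∀ i, n ≤ i → m i = 0}) (g := monomialValue q) (Finsupp.mapDomain Fin.val) ?_
        fun a _ => (monomialValue_mapDomain q a).symm]
    · refine finsum_congr fun m => ?_
      rw [finsum_eq_if]
      simp only [Set.mem_ofPred_eq]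
      by_cases h1 : (m.degree : ℤ) = j
      · by_cases h2 : ∀ i, n ≤ i → m i = 0
        · rw [if_pos h1, if_pos ⟨h1, h2⟩]
        · rw [if_pos h1, if_neg fun h => h2 h.2]
          push Not at h2
          obtain ⟨i, hi, hmi⟩ := h2
          exact monomialValue_eq_zero hi hmi
      · rw [if_neg h1, if_neg fun h => h1 h.1]
    · refine ⟨fun a ha => ⟨?_, fun i hi => ?_⟩, fun a _ b _ h =>
        Finsupp.mapDomain_injective Fin.val_injective h, fun m hm => ?_⟩
      · rw [← (show (a.degree : ℤ) = j from ha)]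
        congr 1
        exact Finsupp.degree_mapDomain _ _
      · refine Finsupp.mapDomain_of_notMem_range _ _ ?_
        rintro ⟨i, rfl⟩
        have := i.2
        omega
      · have hm2 : (m.support : Set ℕ) ⊆ Set.range (Fin.val : Fin n → ℕ) := by
          intro i hi
          rw [Fin.range_val]
          by_contra h
          exact Finsupp.mem_support_iff.1 hi (hm.2 i (by simpa using h))
        have h := Finsupp.mapDomain_comapDomain (Fin.val : Fin n → ℕ) Fin.val_injective m hm2
        refine ⟨_, ?_, h⟩
        have h1 := hm.1
        rw [← h] at h1
        rw [Set.mem_ofPred_eq, ← h1]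
        congr 1
        exact (Finsupp.degree_mapDomain _ _).symm
  refine PowerSeries.ext fun k => ?_
  rw [coeff_specialize, PowerSeries.coeff_C_mul, PowerSeries.coeff_X_pow]
  simp only [coeff_completeSeries]
  by_cases hk : (k : ℤ) = j
  · rw [if_pos (by omega), mul_one, ← hval]
    refine finsum_congr fun m => ?_
    by_cases h : m.degree = k
    · rw [if_pos h, if_pos (by omega), if_pos (by omega), one_mul]
    · rw [if_neg h, if_neg (by omega)]
  · have h0 : (∑ᶠ m : ℕ →₀ ℕ, if m.degree = k then
        (if (m.degree : ℤ) = j then (1 : ℂ) else 0) * monomialValue q m else 0) = 0 := by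
      refine finsum_eq_zero_of_forall_eq_zero fun m => ?_
      by_cases h : m.degree = k
      · rw [if_pos h, if_neg (by omega), zero_mul]
      · rw [if_neg h]
    rw [h0]
    -- For negative j the exponent `j.toNat` is 0, and it is the vanishing of `completeValue q j`
    -- that kills the coefficient.
    rcases lt_or_ge j 0 with hj | hj
    · rw [← hval, finsum_eq_zero_of_forall_eq_zero fun m => if_neg (by omega), zero_mul]
    · rw [if_neg (by omega), mul_zero]

theorem specialize_powerSum {n : ℕ} (q : Fin n → ℂ) {k : ℕ} (hk : 0 < k) :
    specialize q (powerSum k) = PowerSeries.C (∑ i, q i ^ k) * PowerSeries.X ^ k := by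
  classical
  refine PowerSeries.ext fun l => ?_
  rw [coeff_specialize, PowerSeries.coeff_C_mul, PowerSeries.coeff_X_pow]
  rw [finsum_eq_sum_of_support_subset (s := (Finset.range n).image fun i => Finsupp.single i k)]
  · rw [Finset.sum_image fun i _ j _ h => (Finsupp.single_left_inj hk.ne').1 h, Finset.sum_range]
    simp only [Finsupp.degree_single, coeff_powerSum, monomialValue, Finset.sum_mul]
    refine Finset.sum_congr rfl fun i _ => ?_
    rw [if_pos (c := ∃ j, Finsupp.single (i : ℕ) k = Finsupp.single j k) ⟨i, rfl⟩]
    simp [extendZero, eq_comm, Finsupp.prod_single_index]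
  · intro m hm
    have hm' : (if m.degree = l then MvPowerSeries.coeff m (powerSum k) * monomialValue q m
      else 0) ≠ 0 := hm
    rw [coeff_powerSum] at hm'
    have h1 : ∃ i : ℕ, m = Finsupp.single i k := by
      by_contra h
      simp [h] at hm'
    obtain ⟨i, rfl⟩ := h1
    simp only [Finset.coe_image, Finset.coe_range, Set.mem_image, Set.mem_Iio]
    refine ⟨i, ?_, rfl⟩
    by_contra h
    rw [monomialValue_eq_zero (i := i) (by omega) (by simpa using hk.ne')] at hm'
    simp at hm'

/-! ### Values of Schur functions. -/

theorem eval_tableauMonomial {lam : YoungDiagram} {n : ℕ} (q : Fin n → ℂ)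
    (T : SemistandardYoungTableau lam) :
    MvPolynomial.eval (fun i : ℕ => if h : i < n then q ⟨i, h⟩ else 0) (tableauMonomial T) =
      monomialValue q (content T) := by
  rw [tableauMonomial_eq, MvPolynomial.eval_monomial, one_mul]
  rfl

/-- These are the only tableaux that can contribute to `schurValue`; finiteness makes its `finsum` a
genuine sum instead of the default 0. -/
theorem finite_boundedTableaux (lam : YoungDiagram) (n : ℕ) :
    {T : SemistandardYoungTableau lam | ∀ i, n ≤ i → content T i = 0}.Finite := by
  have key : ∀ T : SemistandardYoungTableau lam, (∀ i, n ≤ i → content T i = 0) →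
      ∀ c ∈ lam.cells, T c.1 c.2 < n := by
    intro T hT c hc
    by_contra h
    have h1 := hT (T c.1 c.2) (by omega)
    rw [content, Finsupp.finsetSum_apply, Finset.sum_eq_zero_iff] at h1
    simpa using h1 c hc
  have hinj : Function.Injective
      fun (T : {T : SemistandardYoungTableau lam | ∀ i, n ≤ i → content T i = 0})
        (c : lam.cells) => (⟨T.1 c.1.1 c.1.2, key T.1 T.2 c.1 c.2⟩ : Fin n) := by
    intro T T' h
    refine Subtype.ext (SemistandardYoungTableau.ext fun i j => ?_)
    by_cases hc : (i, j) ∈ lam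
    · exact congrArg Fin.val (congrFun h ⟨(i, j), hc⟩)
    · rw [T.1.zeros hc, T'.1.zeros hc]
  have := Finite.of_injective _ hinj
  exact Set.toFinite _

theorem specialize_schurFunction {n : ℕ} (q : Fin n → ℂ) (lam : YoungDiagram) :
    specialize q (schurFunction lam) =
      PowerSeries.C (schurValue lam q) * PowerSeries.X ^ lam.card := by
  classical
  set S := (finite_boundedTableaux lam n).toFinset with hS
  have hmem : ∀ T : SemistandardYoungTableau lam, monomialValue q (content T) ≠ 0 → T ∈ S := by
    intro T hT
    rw [hS, Set.Finite.mem_toFinset]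
    intro i hi
    by_contra h
    exact hT (monomialValue_eq_zero hi h)
  have hval : schurValue lam q = ∑ T ∈ S, monomialValue q (content T) := by
    rw [schurValue, finsum_congr (eval_tableauMonomial q)]
    exact finsum_eq_sum_of_support_subset _ fun T hT => hmem T hT
  have hK : ∀ m, MvPowerSeries.coeff m (schurFunction lam) * monomialValue q m =
      (S.filter fun T => content T = m).card • monomialValue q m := by
    intro m
    by_cases h0 : monomialValue q m = 0
    · simp [h0]
    · rw [nsmul_eq_mul]
      congr 1
      have hset : {T : SemistandardYoungTableau lam | content T = m} =
          ↑(S.filter fun T => content T = m) := by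
        ext T
        simp only [Set.mem_ofPred_eq, Finset.coe_filter, iff_and_self]
        rintro rfl
        exact hmem T h0
      rw [schurFunction_coeff, hset, finsum_mem_coe_finset]
      simp
  refine PowerSeries.ext fun k => ?_
  rw [coeff_specialize, PowerSeries.coeff_C_mul, PowerSeries.coeff_X_pow]
  simp only [hK]
  rw [finsum_eq_sum_of_support_subset (s := S.image content)]
  · split_ifs with hk
    · rw [mul_one, hval, Finset.sum_comp]
      refine Finset.sum_congr rfl fun m hm => ?_
      obtain ⟨T, _, rfl⟩ := Finset.mem_image.1 hm
      rw [if_pos (by rw [degree_content, hk])]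
    · rw [mul_zero]
      refine Finset.sum_eq_zero fun m hm => ?_
      obtain ⟨T, _, rfl⟩ := Finset.mem_image.1 hm
      rw [if_neg (by rw [degree_content]; exact fun h => hk h.symm)]
  · intro m hm
    by_contra h
    refine hm ?_
    have h1 : (S.filter fun T => content T = m) = ∅ := by
      rw [Finset.filter_eq_empty_iff]
      rintro T hT rfl
      exact h (Finset.mem_coe.2 (Finset.mem_image_of_mem _ hT))
    simp [h1]

theorem schurValue_twoRows {n : ℕ} (q : Fin n → ℂ) (d : ℕ) :
    schurValue (twoRows d) q = completeValue q d * completeValue q d -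
      completeValue q (d + 1) * completeValue q (d - 1) := by
  have h := congrArg (PowerSeries.coeff (2 * d)) (specialize_schurFunction q (twoRows d))
  rw [schurFunction_twoRows, card_twoRows, map_sub, map_mul, map_mul, specialize_completeSeries,
    specialize_completeSeries, specialize_completeSeries, PowerSeries.coeff_C_mul_X_pow,
    if_pos rfl, map_sub] at h
  rw [← h]
  have hC : ∀ (x y : ℂ) (i j : ℕ), (PowerSeries.C x * PowerSeries.X ^ i) *
      (PowerSeries.C y * PowerSeries.X ^ j) =
        PowerSeries.C (x * y) * (PowerSeries.X ^ (i + j) : PowerSeries ℂ) := by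
    intro x y i j
    rw [map_mul, pow_add]
    ring
  rw [hC, hC, PowerSeries.coeff_C_mul_X_pow, PowerSeries.coeff_C_mul_X_pow, if_pos (by simp; omega)]
  congr 1
  -- At d = 0 truncation gives (d - 1).toNat = 0, so the exponents add up to 1 instead of 2d = 0;
  -- the term vanishes anyway because h_{-1} = 0.
  rcases Nat.eq_zero_or_pos d with rfl | hd
  · have h0 : completeValue q (-1) = 0 := by
      rw [completeValue]
      refine finsum_mem_eq_zero_of_forall_eq_zero fun a ha => ?_
      have ha' : (a.degree : ℤ) = -1 := ha
      omega
    simp [h0]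
  · rw [if_pos (by omega)]

/-- Specializing f = P(p_1, p_2, …) gives P evaluated at the p_k(q) T^k. Both sides are polynomials
in T, so T may be set to 1. -/
theorem eval_eq_schurValue {P : MvPolynomial ℕ+ ℂ} {lam : YoungDiagram}
    (hP : IsPowerSumExpansion P (schurFunction lam)) {n : ℕ} (q : Fin n → ℂ) :
    MvPolynomial.eval (fun k : ℕ+ => ∑ i, q i ^ (k : ℕ)) P = schurValue lam q := by
  have h := congrArg (specialize q) hP
  rw [specialize_schurFunction, MvPolynomial.comp_aeval_apply] at h
  have h1 : MvPolynomial.aeval (fun k : ℕ+ => Polynomial.C (∑ i, q i ^ (k : ℕ)) *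
      (Polynomial.X : Polynomial ℂ) ^ (k : ℕ)) P =
        Polynomial.C (schurValue lam q) * Polynomial.X ^ lam.card := by
    refine Polynomial.coe_injective ℂ ?_
    have h2 := MvPolynomial.comp_aeval_apply (fun k : ℕ+ => Polynomial.C (∑ i, q i ^ (k : ℕ)) *
      (Polynomial.X : Polynomial ℂ) ^ (k : ℕ)) (Polynomial.coeToPowerSeries.algHom ℂ) P
    simp only [Polynomial.coeToPowerSeries.algHom_apply, Algebra.algebraMap_self,
      PowerSeries.map_id, id_eq] at h2
    simp only [Polynomial.coe_mul, Polynomial.coe_C, Polynomial.coe_pow, Polynomial.coe_X] at h2 ⊢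
    rw [h2, ← h]
    congr 2
    exact funext fun k => (specialize_powerSum q k.pos).symm
  have h3 := congrArg (Polynomial.aeval (1 : ℂ)) h1
  rw [MvPolynomial.comp_aeval_apply] at h3
  simpa [MvPolynomial.aeval_eq_eval, Polynomial.eval_finsetSum] using h3

/-! ### Permutation matrices -/

/-- The polynomial X^N - 1 is separable over ℂ and kills f, so f is semisimple and its eigenvectors
span. -/
theorem exists_basis_eigenvectors {V : Type*} [AddCommGroup V] [Module ℂ V] [Module.Finite ℂ V]
    {f : Module.End ℂ V} {N : ℕ} (hN : 0 < N) (hf : f ^ N = 1) {n : ℕ}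
    (hn : Module.finrank ℂ V = n) :
    ∃ (b : Module.Basis (Fin n) ℂ V) (q : Fin n → ℂ), ∀ i, f (b i) = q i • b i := by
  have hss : f.IsSemisimple := by
    refine Module.End.isSemisimple_of_squarefree_aeval_eq_zero
      (p := Polynomial.X ^ N - Polynomial.C 1) ?_ ?_
    · exact (Polynomial.separable_X_pow_sub_C 1 (by exact_mod_cast hN.ne') one_ne_zero).squarefree
    · simp [hf]
  set s : Set V := {v | ∃ c : ℂ, f v = c • v} with hs
  have hspan : ⊤ ≤ Submodule.span ℂ s := by
    rw [← hss.iSup_eigenspace_eq_top, iSup_le_iff]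
    exact fun c v hv => Submodule.subset_span ⟨c, Module.End.mem_eigenspace_iff.1 hv⟩
  obtain ⟨t, hts, hspan', hli⟩ := exists_linearIndependent ℂ s
  rw [← hspan'] at hspan
  let b : Module.Basis t ℂ V := Module.Basis.mk hli (by simpa using hspan)
  have hb : ∀ i, ∃ c : ℂ, f (b i) = c • b i := by
    intro i
    obtain ⟨c, hc⟩ := hts i.2
    exact ⟨c, by simpa [b] using hc⟩
  have := Module.Finite.finite_basis b
  have := Fintype.ofFinite t
  let e : t ≃ Fin n := Fintype.equivFinOfCardEq (by rw [← hn, Module.finrank_eq_card_basis b])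
  choose q hq using hb
  refine ⟨b.reindex e, fun i => q (e.symm i), fun i => ?_⟩
  rw [Module.Basis.reindex_apply]
  exact hq _

/-- Matrices of finite order are diagonalizable. -/
theorem exists_conj_eq_diagonal {n N : ℕ} (hN : 0 < N) {M : Matrix.GeneralLinearGroup (Fin n) ℂ}
    (hM : M ^ N = 1) :
    ∃ (U : Matrix.GeneralLinearGroup (Fin n) ℂ) (q : Fin n → ℂ),
      ((U * M * U⁻¹ : Matrix.GeneralLinearGroup (Fin n) ℂ) : Matrix (Fin n) (Fin n) ℂ) =
        Matrix.diagonal q := by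
  obtain ⟨b, q, hq⟩ := exists_basis_eigenvectors (f := Matrix.toLin' (M : Matrix (Fin n) (Fin n) ℂ))
    hN (by
      rw [← Matrix.toLin'_pow, ← Units.val_pow_eq_pow_val, hM, Units.val_one, Matrix.toLin'_one]
      rfl) (Module.finrank_fin_fun ℂ)
  let U : Matrix.GeneralLinearGroup (Fin n) ℂ :=
    { val := b.toMatrix (Pi.basisFun ℂ (Fin n))
      inv := (Pi.basisFun ℂ (Fin n)).toMatrix b
      val_inv := b.toMatrix_mul_toMatrix_flip _
      inv_val := (Pi.basisFun ℂ (Fin n)).toMatrix_mul_toMatrix_flip _ }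
  refine ⟨U, q, ?_⟩
  have h : (M : Matrix (Fin n) (Fin n) ℂ) * ((U⁻¹ : Matrix.GeneralLinearGroup (Fin n) ℂ) :
      Matrix (Fin n) (Fin n) ℂ) = ((U⁻¹ : Matrix.GeneralLinearGroup (Fin n) ℂ) :
      Matrix (Fin n) (Fin n) ℂ) * Matrix.diagonal q := by
    ext i j
    have h1 := congrFun (hq j) i
    rw [Matrix.toLin'_apply] at h1
    rw [Matrix.mul_diagonal]
    change ((M : Matrix (Fin n) (Fin n) ℂ).mulVec (b j)) i = b j i * q j
    rw [h1, Pi.smul_apply, smul_eq_mul, mul_comm]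
  rw [mul_assoc, Units.val_mul, Units.val_mul, h, ← mul_assoc, ← Units.val_mul, mul_inv_cancel,
    Units.val_one, one_mul]

/-- The matrix `g` for which `f(X g)` permutes the columns of `X` by `σ`. -/
def permGL (n : ℕ) : Equiv.Perm (Fin n) →* Matrix.GeneralLinearGroup (Fin n) ℂ :=
  (Matrix.permMatrixHom (n := Fin n) (R := ℂ)).toHomUnits

theorem coe_permGL {n : ℕ} (σ : Equiv.Perm (Fin n)) :
    (permGL n σ : Matrix (Fin n) (Fin n) ℂ) = (σ⁻¹).permMatrix ℂ := rfl

theorem columnRep_eq_glRep {n d : ℕ} (σ : Equiv.Perm (Fin n)) :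
    columnRep n d σ = glRep n d (permGL n σ) := by
  refine LinearMap.ext fun f => Subtype.ext ?_
  change columnSubst n σ f = rightSubst n (permGL n σ) f
  congr 1
  refine MvPolynomial.algHom_ext fun v => ?_
  simp [columnSubst, rightSubst, coe_permGL, PEquiv.toMatrix_apply, Equiv.toPEquiv_apply,
    apply_ite MvPolynomial.C, Equiv.symm_apply_eq]

theorem exists_diagonal_columnRep {n d : ℕ} (σ : Equiv.Perm (Fin n)) :
    ∃ q : Fin n → ℂ, (columnRep n d).character σ = schurValue (twoRows d) q ∧
      (σ.permMatrix ℂ).charpoly = ∏ i, (Polynomial.X - Polynomial.C (q i)) ∧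
      ∀ k : ℕ, ∑ i, q i ^ k = (((σ⁻¹) ^ k).permMatrix ℂ).trace := by
  obtain ⟨U, q, hU⟩ := exists_conj_eq_diagonal (orderOf_pos σ)
    (M := permGL n σ) (by rw [← map_pow, pow_orderOf_eq_one, map_one])
  refine ⟨q, ?_, ?_, fun k => ?_⟩
  · have h : (columnRep n d).character σ = (glRep n d).character (permGL n σ) := by
      rw [Representation.character, Representation.character, columnRep_eq_glRep]
    rw [h, ← Representation.char_conj _ _ U, character_glRep_diagonal hU, schurValue_twoRows]
  -- `permGL` uses the matrix of σ⁻¹, the transpose of that of σ, so the characteristic polynomial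
  -- is the same.
  · rw [← Matrix.charpoly_diagonal, ← hU, Units.val_mul, Units.val_mul, Matrix.coe_units_inv,
      Matrix.charpoly_units_conj, coe_permGL, ← Matrix.transpose_permMatrix, Matrix.charpoly_transpose]
  · have h : Matrix.diagonal q ^ k = (U : Matrix (Fin n) (Fin n) ℂ) *
        (permGL n (σ ^ k) : Matrix (Fin n) (Fin n) ℂ) * (U⁻¹ : Matrix.GeneralLinearGroup _ ℂ) := by
      rw [← hU, ← Units.val_pow_eq_pow_val, conj_pow, map_pow, Units.val_mul, Units.val_mul]
    rw [Matrix.diagonal_pow] at h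
    have h1 := congrArg Matrix.trace h
    rw [Matrix.trace_diagonal, Matrix.trace_mul_cycle, ← Units.val_mul, inv_mul_cancel,
      Units.val_one, one_mul, coe_permGL, ← inv_pow] at h1
    simpa using h1

theorem sum_pow_eq_of_prod_eq {n : ℕ} {q r : Fin n → ℂ}
    (h : ∏ i, (Polynomial.X - Polynomial.C (q i)) = ∏ i, (Polynomial.X - Polynomial.C (r i)))
    (k : ℕ) : ∑ i, q i ^ k = ∑ i, r i ^ k := by
  have key : ∀ s : Fin n → ℂ, (∏ i, (Polynomial.X - Polynomial.C (s i))).roots =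
      Finset.univ.val.map s := by
    intro s
    rw [← Polynomial.roots_multiset_prod_X_sub_C (Finset.univ.val.map s), Multiset.map_map]
    rfl
  have h1 := congrArg Polynomial.roots h
  rw [key, key] at h1
  have h2 := congrArg (fun t : Multiset ℂ => (t.map (· ^ k)).sum) h1
  simp only [Multiset.map_map] at h2
  exact h2

/-- The given q need not be the enumeration produced by the diagonalization. As s_dd is a polynomial
in power sums, only the multiset of eigenvalues matters. -/
theorem character_columnRep {n d : ℕ} {σ : Equiv.Perm (Fin n)} {q : Fin n → ℂ}
    (hq : (σ.permMatrix ℂ).charpoly = ∏ i, (Polynomial.X - Polynomial.C (q i))) :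
    (columnRep n d).character σ = schurValue (twoRows d) q := by
  obtain ⟨r, h1, h2, _⟩ := exists_diagonal_columnRep (d := d) σ
  obtain ⟨P, hP⟩ := exists_isPowerSumExpansion d
  rw [h1, ← eval_eq_schurValue hP, ← eval_eq_schurValue hP]
  congr 2
  exact funext fun k => sum_pow_eq_of_prod_eq (h2.symm.trans hq) k

/-! ### Cycle types -/

open Equiv.Perm in
-- The k-th power of a cycle of length a fixes all of its points if a ∣ k and none otherwise;
-- disjoint cycles contribute additively.
theorem card_support_filter_pow {α : Type*} [Fintype α] [DecidableEq α] (σ : Equiv.Perm α)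
    (k : ℕ) : (σ.support.filter fun i => (σ ^ k) i = i).card =
      (σ.cycleType.filter fun a => a ∣ k).sum := by
  induction σ using cycle_induction_on with
  | base_one => simp
  | base_cycles σ hσ =>
    rw [hσ.cycleType, Multiset.filter_singleton]
    by_cases h : σ.support.card ∣ k
    · have h1 : σ ^ k = 1 := by
        rwa [← orderOf_dvd_iff_pow_eq_one, hσ.orderOf]
      simp [h, h1]
    · rw [if_neg h, Multiset.empty_eq_zero, Multiset.sum_zero, Finset.card_eq_zero,
        Finset.filter_eq_empty_iff]
      intro x hx h1
      rw [← hσ.pow_eq_one_iff' (mem_support.1 hx), ← orderOf_dvd_iff_pow_eq_one, hσ.orderOf] at h1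
      exact h h1
  | induction_disjoint σ τ hd _ hσ hτ =>
    rw [hd.cycleType_mul, Multiset.filter_add, Multiset.sum_add, ← hσ, ← hτ, hd.support_mul,
      Finset.filter_union, Finset.card_union_of_disjoint]
    · have key : ∀ σ τ : Equiv.Perm α, σ.Disjoint τ → ∀ i ∈ σ.support,
          ((σ * τ) ^ k) i = (σ ^ k) i := by
        intro σ τ hd i hi
        have h1 : τ i = i := (hd i).resolve_left (mem_support.1 hi)
        rw [hd.commute.mul_pow, mul_apply, pow_apply_eq_self_of_apply_eq_self h1]
      congr 2
      · exact Finset.filter_congr fun i hi => by rw [key σ τ hd i hi]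
      · exact Finset.filter_congr fun i hi => by rw [hd.commute.eq, key τ σ hd.symm i hi]
    · exact Finset.disjoint_filter_filter hd.disjoint_support

theorem card_fixed_pow {n : ℕ} (σ : Equiv.Perm (Fin n)) (k : ℕ) :
    (Finset.univ.filter fun i => (σ ^ k) i = i).card = dividingParts σ.partition k := by
  have h1 : (Finset.univ.filter fun i => (σ ^ k) i = i) =
      (σ.support.filter fun i => (σ ^ k) i = i) ∪ σ.supportᶜ := by
    ext i
    simp only [Finset.mem_filter, Finset.mem_univ, true_and, Finset.mem_union, Finset.mem_compl,
      Equiv.Perm.mem_support, not_not]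
    by_cases h : σ i = i
    · simp [h, Equiv.Perm.pow_apply_eq_self_of_apply_eq_self h k]
    · simp [h]
  rw [h1, Finset.card_union_of_disjoint, card_support_filter_pow, dividingParts,
    Equiv.Perm.parts_partition, Multiset.filter_add, Multiset.sum_add, Finset.card_compl]
  · congr 1
    rw [Multiset.filter_eq_self.2 fun a ha => by
      rw [Multiset.eq_of_mem_replicate ha]
      exact one_dvd k]
    simp
  · exact Finset.disjoint_of_subset_left (Finset.filter_subset _ _) disjoint_compl_right

/-- The partition of `n` formed by the cycle lengths of `σ`. -/
def cyclePartition {n : ℕ} (σ : Equiv.Perm (Fin n)) : n.Partition where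
  parts := σ.partition.parts
  parts_pos := σ.partition.parts_pos
  parts_sum := σ.partition.parts_sum.trans (Fintype.card_fin n)

/-- `cycleType` omits fixed points; the parts at least 2 still determine the partition, by padding
with ones. -/
theorem parts_eq_filter_add_replicate {n : ℕ} (μ : n.Partition) :
    μ.parts = μ.parts.filter (2 ≤ ·) +
      Multiset.replicate (n - (μ.parts.filter (2 ≤ ·)).sum) 1 := by
  have h1 := Multiset.filter_add_not (2 ≤ ·) μ.parts
  have h2 : μ.parts.filter (fun a => ¬ 2 ≤ a) =
      Multiset.replicate (μ.parts.filter (fun a => ¬ 2 ≤ a)).card 1 := by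
    refine Multiset.eq_replicate_card.2 fun a ha => ?_
    obtain ⟨h3, h4⟩ := Multiset.mem_filter.1 ha
    have := μ.parts_pos h3
    omega
  have h5 := congrArg Multiset.sum h1
  rw [Multiset.sum_add, h2, Multiset.sum_replicate, μ.parts_sum, smul_eq_mul, mul_one] at h5
  have h6 : n - (μ.parts.filter (2 ≤ ·)).sum = (μ.parts.filter (fun a => ¬ 2 ≤ a)).card := by omega
  rw [h6, ← h2, h1]

theorem cyclePartition_eq_iff {n : ℕ} (σ : Equiv.Perm (Fin n)) (μ : n.Partition) :
    cyclePartition σ = μ ↔ σ.cycleType = μ.parts.filter (2 ≤ ·) := by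
  rw [Nat.Partition.ext_iff]
  change σ.partition.parts = μ.parts ↔ _
  constructor
  · intro h
    rw [← h, Equiv.Perm.filter_parts_partition_eq_cycleType]
  · intro h
    rw [parts_eq_filter_add_replicate μ, ← h, Equiv.Perm.parts_partition, Fintype.card_fin,
      Equiv.Perm.sum_cycleType]

theorem prod_toFinset_add_replicate {m : Multiset ℕ} (hm : ∀ a ∈ m, 2 ≤ a) (c : ℕ) :
    ∏ i ∈ (m + Multiset.replicate c 1).toFinset, i ^ (m + Multiset.replicate c 1).count i *
        ((m + Multiset.replicate c 1).count i).factorial =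
      c.factorial * m.prod * ∏ i ∈ m.toFinset, (m.count i).factorial := by
  have h1 : 1 ∉ m := fun h => by simpa using hm 1 h
  have h2 : ∏ i ∈ m.toFinset, i ^ m.count i * (m.count i).factorial =
      m.prod * ∏ i ∈ m.toFinset, (m.count i).factorial := by
    rw [Finset.prod_mul_distrib, ← Finset.prod_multiset_count]
  rcases Nat.eq_zero_or_pos c with rfl | hc
  · simpa using h2
  · have h3 : (m + Multiset.replicate c 1).toFinset = insert 1 m.toFinset := by
      ext i
      simp [hc.ne', or_comm]
    rw [h3, Finset.prod_insert (by simpa using h1), mul_assoc c.factorial, ← h2]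
    congr 1
    · simp [Multiset.count_eq_zero_of_notMem h1]
    · refine Finset.prod_congr rfl fun i hi => ?_
      have h4 : i ≠ 1 := by
        rintro rfl
        exact h1 (Multiset.mem_toFinset.1 hi)
      simp [Multiset.count_replicate, h4.symm]

/-- z_μ is the order of the centralizer of a permutation of cycle type μ; its factor for i = 1
accounts for the permutations of the fixed points. -/
theorem card_cyclePartition_mul_zPart {n : ℕ} (μ : n.Partition)
    [DecidablePred fun σ : Equiv.Perm (Fin n) => cyclePartition σ = μ] :
    (Finset.univ.filter fun σ : Equiv.Perm (Fin n) => cyclePartition σ = μ).card * zPart μ =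
      n.factorial := by
  set m := μ.parts.filter (2 ≤ ·) with hm
  have hm2 : ∀ a ∈ m, 2 ≤ a := fun a ha => (Multiset.mem_filter.1 ha).2
  have hsum : m.sum ≤ n := by
    have h := Multiset.filter_add_not (2 ≤ ·) μ.parts
    rw [← μ.parts_sum, ← h, Multiset.sum_add]
    exact Nat.le_add_right _ _
  have h := Equiv.Perm.card_of_cycleType_mul_eq (Fin n) m
  rw [Fintype.card_fin, if_pos ⟨hsum, hm2⟩] at h
  rw [← h, zPart, parts_eq_filter_add_replicate μ, ← hm, prod_toFinset_add_replicate hm2]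
  congr 2
  exact Finset.filter_congr fun σ _ => cyclePartition_eq_iff σ μ

theorem frobeniusChar_columnRep {n d : ℕ} {P : MvPolynomial ℕ+ ℂ}
    (hP : IsPowerSumExpansion P (schurFunction (twoRows d))) :
    frobeniusChar (columnRep n d) = ∑ μ : n.Partition,
      (MvPolynomial.eval (fun k : ℕ+ => (dividingParts μ (k : ℕ) : ℂ)) P / (zPart μ : ℂ)) •
        powerSumPart μ := by
  classical
  have hchar : ∀ σ : Equiv.Perm (Fin n), (columnRep n d).character σ =
      MvPolynomial.eval (fun k : ℕ+ => (dividingParts (cyclePartition σ) (k : ℕ) : ℂ)) P := by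
    intro σ
    obtain ⟨q, h1, _, h3⟩ := exists_diagonal_columnRep (d := d) σ
    rw [h1, ← eval_eq_schurValue hP]
    congr 2
    funext k
    -- `σ.partition` is indexed by `Fintype.card (Fin n)` and `cyclePartition σ` by `n`, but
    -- `dividingParts` sees only the common parts.
    have h4 : dividingParts (cyclePartition σ) k = dividingParts σ.partition k := rfl
    rw [h3, h4, ← card_fixed_pow, inv_pow, ← Matrix.transpose_permMatrix, Matrix.trace_transpose,
      Matrix.trace_permutation]
    congr 1
    rw [← Set.ncard_coe_finset]
    congr 1
    ext i
    simp [Function.fixedPoints, Function.IsFixedPt]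
  rw [frobeniusChar]
  have hsum : ∑ σ : Equiv.Perm (Fin n), (columnRep n d).character σ • powerSumPart σ.partition =
      ∑ μ : n.Partition, (Finset.univ.filter fun σ : Equiv.Perm (Fin n) =>
        cyclePartition σ = μ).card •
        (MvPolynomial.eval (fun k : ℕ+ => (dividingParts μ (k : ℕ) : ℂ)) P • powerSumPart μ) := by
    rw [← Finset.sum_fiberwise (s := Finset.univ) (g := cyclePartition)]
    refine Finset.sum_congr rfl fun μ _ => ?_
    rw [← Finset.sum_const]
    refine Finset.sum_congr rfl fun σ hσ => ?_
    rw [hchar, ← (Finset.mem_filter.1 hσ).2]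
    rfl
  rw [hsum, Finset.smul_sum]
  refine Finset.sum_congr rfl fun μ _ => ?_
  have h := card_cyclePartition_mul_zPart μ
  have hz : (zPart μ : ℂ) ≠ 0 := by
    intro h0
    rw [Nat.cast_eq_zero] at h0
    rw [h0, mul_zero] at h
    exact n.factorial_ne_zero h.symm
  have hn : (n.factorial : ℂ) ≠ 0 := by exact_mod_cast n.factorial_ne_zero
  have h' : (((Finset.univ.filter fun σ : Equiv.Perm (Fin n) =>
      cyclePartition σ = μ).card : ℕ) : ℂ) * zPart μ = n.factorial := by exact_mod_cast h
  rw [← Nat.cast_smul_eq_nsmul ℂ, smul_smul, smul_smul]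
  congr 1
  rw [inv_mul_eq_div, div_mul_eq_mul_div, div_eq_div_iff hn hz, ← h']
  ring

end

end SLTwoInvariants

open SLTwoInvariants in
theorem mainTheorem7 (n d : ℕ) :
    -- the character of `GL_n` on the degree `d` component of `R_n` is `s_{dd}(q_1, …, q_n)`
    (∀ (g : Matrix.GeneralLinearGroup (Fin n) ℂ) (q : Fin n → ℂ),
      (g : Matrix (Fin n) (Fin n) ℂ) = Matrix.diagonal q →
        (glRep n d).character g = schurValue (twoRows d) q) ∧
    -- the character of `S_n` at `σ` is `s_{dd}` at the eigenvalues of the permutation matrix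
    (∀ (σ : Equiv.Perm (Fin n)) (q : Fin n → ℂ),
      (σ.permMatrix ℂ).charpoly = ∏ i, (Polynomial.X - Polynomial.C (q i)) →
        (columnRep n d).character σ = schurValue (twoRows d) q) ∧
    -- the Frobenius characteristic
    (∃ P : MvPolynomial ℕ+ ℂ, IsPowerSumExpansion P (schurFunction (twoRows d))) ∧
    (∀ P : MvPolynomial ℕ+ ℂ, IsPowerSumExpansion P (schurFunction (twoRows d)) →
      frobeniusChar (columnRep n d) =
        ∑ μ : n.Partition,
          (MvPolynomial.eval (fun k : ℕ+ => (dividingParts μ (k : ℕ) : ℂ)) P / (zPart μ : ℂ)) •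
            powerSumPart μ) := by
  refine ⟨fun g q hg => ?_, fun σ q hq => character_columnRep hq, exists_isPowerSumExpansion d,
    fun P hP => frobeniusChar_columnRep hP⟩
  rw [character_glRep_diagonal hg, schurValue_twoRows]
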